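/- An instance of Optimal House Allocation of Agent Network consists of a finite set $\mathcal A$ of $n$ agents, a finite set $\mathcal H$ of $m$ houses with $n\le m$, a (simple, undirected) agent graph $\mathcal G$ on $\mathcal A$, and for each agent $a$ a set $\mathcal P_a\subseteq\mathcal H$ of preferred houses. An allocation is an injective map $\phi:\mathcal A\to\mathcal H$. An agent $a$ is envious under $\phi$ if $\phi(a)\notin\mathcal P_a$ and $\phi(a')\in\mathcal P_a$ for some neighbour $a'$ of $a$ in $\mathcal G$. The task is to compute an allocation that minimizes the number of envious agents. Theorem. There is an algorithm that, given $\mathcal A,\mathcal H,\mathcal G,(\mathcal P_a)_{a\in\mathcal A}$ (with $\mathcal G$ and the preferences given as $0$-$1$ matrices), outputs an allocation with the minimum number of envious agents, together with that number, in time $O\big((2m)^k\cdot (n+m)^{O(1)}\big)$, where $k$ is the size of a vertex cover of $\mathcal G$. Precisely: there are a program $p$ for a random access machine with logarithmic cost and constants $C,c\in\mathbb N$ such that on every instance $p$ halts with such an output, and for every vertex cover $S$ of $\mathcal G$ (which is not part of the input) the running time is at most $C\,(2m)^{|S|}(n+m+1)^c$. -/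

import Mathlib

/-! ### House allocation on an agent graph -/

namespace HouseAllocation

/-- The set of neighbours of the agent `a` that `a` envies under the allocation `φ`: `a` does not
receive a house she prefers, while the neighbour does receive a house that `a` prefers. -/
def envySet {A H : Type*} (G : SimpleGraph A) (P : A → Finset H) (φ : A ↪ H) (a : A) : Set A :=
  {a' | G.Adj a a' ∧ φ a ∉ P a ∧ φ a' ∈ P a}

/-- The envy of an allocation: the number of envious agents. -/
noncomputable def envy {A H : Type*} (G : SimpleGraph A) (P : A → Finset H) (φ : A ↪ H) : ℕ :=
  {a : A | (envySet G P φ a).Nonempty}.ncard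

/-- `φ` is a solution of the problem Optimal House Allocation of Agent Network. -/
def IsOptimal {A H : Type*} (G : SimpleGraph A) (P : A → Finset H) (φ : A ↪ H) : Prop :=
  ∀ ψ : A ↪ H, envy G P φ ≤ envy G P ψ

end HouseAllocation

/-! ### Random access machines with logarithmic cost

The memory of the machine consists of arrays of natural numbers of unbounded length. A program is
a fixed finite text, the name of an array is a literal of the text, so a program uses only finitely
many arrays (which can be interleaved in a single linear memory), while indices are computed.
Scalar variables are the cells with index `0`. Every operation is charged the bit length of the
numbers it handles (logarithmic cost criterion), so big numbers give no hidden parallelism. -/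

namespace RAM

/-- The contents of the memory: `s x i` is the number in cell `i` of the array `x`. -/
abbrev Mem := ℕ → ℕ → ℕ

/-- Write `v` into cell `i` of the array `x`. -/
def Mem.write (s : Mem) (x i v : ℕ) : Mem :=
  Function.update s x (Function.update (s x) i v)

/-- The arithmetical operations and tests of the machine. -/
inductive Op where
  | add | sub | mul | div | mod | lt | eq

/-- Subtraction is truncated at `0`, division rounds down (with `a / 0 = 0` and `a % 0 = a`),
and tests return `1` for true and `0` for false. -/
def Op.eval : Op → ℕ → ℕ → ℕ
  | .add, a, b => a + b
  | .sub, a, b => a - b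
  | .mul, a, b => a * b
  | .div, a, b => a / b
  | .mod, a, b => a % b
  | .lt, a, b => if a < b then 1 else 0
  | .eq, a, b => if a = b then 1 else 0

/-- Expressions: literals, reading a cell of an array, and applying an operation. -/
inductive Expr where
  | lit (c : ℕ)
  | get (x : ℕ) (i : Expr)
  | op (o : Op) (e f : Expr)

/-- The value of an expression. -/
def Expr.eval (s : Mem) : Expr → ℕ
  | .lit c => c
  | .get x i => s x (i.eval s)
  | .op o e f => o.eval (e.eval s) (f.eval s)

/-- The logarithmic cost of evaluating an expression: each node of the expression costs one plus
the number of binary digits of its value. -/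
def Expr.cost (s : Mem) : Expr → ℕ
  | .lit c => 1 + c.size
  | .get x i => i.cost s + (1 + (s x (i.eval s)).size)
  | .op o e f => e.cost s + f.cost s + (1 + (o.eval (e.eval s) (f.eval s)).size)

/-- Programs. `write x i e` stores the value of `e` in the cell of the array `x` whose index is
the value of `i`; a condition is true if its value is not `0`. -/
inductive Cmd where
  | skip
  | write (x : ℕ) (i e : Expr)
  | seq (p q : Cmd)
  | ite (e : Expr) (p q : Cmd)
  | loop (e : Expr) (p : Cmd)

/-- `Exec p s t s'`: the program `p`, started with the memory `s`, halts after time `t` with the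
memory `s'`. -/
inductive Exec : Cmd → Mem → ℕ → Mem → Prop where
  | skip (s : Mem) : Exec .skip s 1 s
  | write (x : ℕ) (i e : Expr) (s : Mem) :
      Exec (.write x i e) s (1 + i.cost s + e.cost s) (s.write x (i.eval s) (e.eval s))
  | seq {p q : Cmd} {s s' s'' : Mem} {t t' : ℕ} (hp : Exec p s t s') (hq : Exec q s' t' s'') :
      Exec (.seq p q) s (t + t') s''
  | ite_true {e : Expr} {p q : Cmd} {s s' : Mem} {t : ℕ} (he : e.eval s ≠ 0)
      (hp : Exec p s t s') : Exec (.ite e p q) s (1 + e.cost s + t) s'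
  | ite_false {e : Expr} {p q : Cmd} {s s' : Mem} {t : ℕ} (he : e.eval s = 0)
      (hq : Exec q s t s') : Exec (.ite e p q) s (1 + e.cost s + t) s'
  | loop_done {e : Expr} {p : Cmd} {s : Mem} (he : e.eval s = 0) :
      Exec (.loop e p) s (1 + e.cost s) s
  | loop_step {e : Expr} {p : Cmd} {s s' s'' : Mem} {t t' : ℕ} (he : e.eval s ≠ 0)
      (hp : Exec p s t s') (hl : Exec (.loop e p) s' t' s'') :
      Exec (.loop e p) s (1 + e.cost s + t + t') s''

end RAM

/-! ### Input and output conventions -/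

namespace HouseAllocation

open scoped Classical in
/-- The memory that holds an instance with agents `0, …, n - 1` and houses `0, …, m - 1`: the array
`0` holds `n, m`, the array `1` holds the adjacency matrix of the agent graph row by row, the array
`2` holds the `0`-`1` matrix of the preferences row by row, and every other cell holds `0`. -/
noncomputable def inputMem {n m : ℕ} (G : SimpleGraph (Fin n)) (P : Fin n → Finset (Fin m)) :
    RAM.Mem := fun x i =>
  if x = 0 then (if i = 0 then n else if i = 1 then m else 0)
  else if x = 1 then (if ∃ a b : Fin n, i = a * n + b ∧ G.Adj a b then 1 else 0)
  else if x = 2 then (if ∃ (a : Fin n) (h : Fin m), i = a * m + h ∧ h ∈ P a then 1 else 0)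
  else 0

/-- The memory holds an optimal allocation (in the array `3`) together with its envy (in cell `0`
of the array `4`). -/
def IsSolutionMem {n m : ℕ} (G : SimpleGraph (Fin n)) (P : Fin n → Finset (Fin m))
    (s : RAM.Mem) : Prop :=
  ∃ φ : Fin n ↪ Fin m, IsOptimal G P φ ∧ (∀ a : Fin n, s 3 a = φ a) ∧ s 4 0 = envy G P φ

end HouseAllocation

/-! ### Hoare logic with running times for the random access machine -/

namespace RAM

/-! Fix a vertex cover `T` and guess, for each agent in `T`, her house and whether she may be
envious: `2 * m` options per agent, `(2 * m) ^ T.card` guesses. An agent outside `T` has all her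
neighbours in `T`, so once the guess is fixed her envy depends only on her own house, and the number
of envious agents outside `T` is a sum of costs of single assignments. Penalties of `n + 1` enforce
the guess: for a wrong house in `T`, and for each unflagged cover agent made envious by a neighbour
outside `T`. If the guess agrees with an allocation `ψ`, then `ψ` costs at most `n`, so an
allocation that is no more expensive pays no penalty and has no more envious agents than `ψ`
(`envy_le_of_guessCost_le`). With `ψ` optimal, some guess leads to the optimum.

The assignment problem is solved by an auction with price steps of one unit. Its result is optimal
up to `n` units (`AuctionInv.exists_assignment`), hence exactly optimal when all costs are
multiplied by `n + 1`. While a bidder is idle, some house is still free at price `0`; this bounds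
all prices, and since every bid raises the sum of the prices by one, the auction ends after
polynomially many bids.

The cover is found by counting: a number in base `2 * m` names a set of agents by its digits. A set
of size `k` has a code below `(2 * m) ^ k`, and a code below `(2 * m) ^ k` names at most `k` agents.
So the first code of a cover is below `(2 * m) ^ S.card`, and its set has at most `S.card` members,
for every cover `S` (`exists_first_cover`).

On the machine side, `Runs` expresses total correctness with a time bound. Only the searches through
the codes and through the guesses are long; every other loop has at most `R` iterations, with `R`
polynomial, and its cost is read off from the program text (`Cmd.exists_bound_le`). All numbers stay
below a bound `M` of polynomial bit length. -/

instance (c : ℕ) : OfNat Expr c := ⟨.lit c⟩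
instance : Add Expr := ⟨.op .add⟩
instance : Sub Expr := ⟨.op .sub⟩
instance : Mul Expr := ⟨.op .mul⟩
instance : Div Expr := ⟨.op .div⟩
instance : Mod Expr := ⟨.op .mod⟩

/-! ### Evaluation and cost of expressions -/

section Eval

variable (s : Mem) (e f : Expr)

@[simp] theorem Expr.eval_zero : (0 : Expr).eval s = 0 := rfl

@[simp] theorem Expr.eval_one : (1 : Expr).eval s = 1 := rfl

@[simp] theorem Expr.eval_two : (2 : Expr).eval s = 2 := rfl

@[simp] theorem Expr.eval_get (x : ℕ) : (Expr.get x e).eval s = s x (e.eval s) := rfl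

@[simp] theorem Expr.eval_add : (e + f).eval s = e.eval s + f.eval s := rfl

@[simp] theorem Expr.eval_sub : (e - f).eval s = e.eval s - f.eval s := rfl

@[simp] theorem Expr.eval_mul : (e * f).eval s = e.eval s * f.eval s := rfl

@[simp] theorem Expr.eval_div : (e / f).eval s = e.eval s / f.eval s := rfl

@[simp] theorem Expr.eval_mod : (e % f).eval s = e.eval s % f.eval s := rfl

@[simp] theorem Expr.eval_lt :
    (Expr.op .lt e f).eval s = if e.eval s < f.eval s then 1 else 0 := rfl

@[simp] theorem Expr.eval_eq :
    (Expr.op .eq e f).eval s = if e.eval s = f.eval s then 1 else 0 := rfl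

end Eval

@[simp] theorem Mem.write_apply (s : Mem) (x i v y j : ℕ) :
    s.write x i v y j = if y = x ∧ j = i then v else s y j := by
  unfold Mem.write
  by_cases hy : y = x
  · subst hy
    by_cases hj : j = i <;> simp [hj]
  · simp [hy]

theorem Mem.write_of_ne (s : Mem) {x y : ℕ} (i v : ℕ) (h : y ≠ x) : s.write x i v y = s y := by
  simp [Mem.write, h]

/-- A bound for the cost of an expression in terms of the length of the numbers in the memory. -/
def Expr.weight : Expr → ℕ
  | .lit c => 1 + c.size
  | .get _ i => i.weight + 1
  | .op _ e f => 2 * (e.weight + f.weight + 1)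

/-- Multiplication accounts for the sum of the sizes; the extra digit covers the carry of an
addition and a test that returns `1` on two zeros. -/
theorem Op.size_eval_le (o : Op) (a b : ℕ) : (o.eval a b).size ≤ a.size + b.size + 1 := by
  rw [Nat.size_le]
  have ha := Nat.lt_size_self a
  have hb := Nat.lt_size_self b
  have hA : 1 ≤ 2 ^ a.size := Nat.one_le_two_pow
  have hB : 1 ≤ 2 ^ b.size := Nat.one_le_two_pow
  rw [pow_succ, pow_add]
  have hab : 2 ^ a.size ≤ 2 ^ a.size * 2 ^ b.size := Nat.le_mul_of_pos_right _ hB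
  have hba : 2 ^ b.size ≤ 2 ^ a.size * 2 ^ b.size := Nat.le_mul_of_pos_left _ hA
  have hmul : a * b < 2 ^ a.size * 2 ^ b.size := Nat.mul_lt_mul'' ha hb
  have hdiv : a / b ≤ a := Nat.div_le_self a b
  have hmod : a % b ≤ a := Nat.mod_le a b
  cases o <;> simp only [Op.eval]
  · omega
  · omega
  · omega
  · omega
  · omega
  · split_ifs <;> omega
  · split_ifs <;> omega

/-- All numbers in the memory are at most `M`. -/
def Mem.Bounded (M : ℕ) (s : Mem) : Prop := ∀ x i, s x i ≤ M

theorem Mem.Bounded.write {M : ℕ} {s : Mem} (hs : s.Bounded M) (x i : ℕ) {v : ℕ} (hv : v ≤ M) :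
    (s.write x i v).Bounded M := by
  intro y j
  rw [Mem.write_apply]
  split_ifs
  · exact hv
  · exact hs y j

/-- Cost and size of the value are bounded together, since an operation is charged for its result,
whose size is controlled by the sizes of both operands. This doubling is the factor `2` in
`Expr.weight`. -/
theorem Expr.cost_le {M : ℕ} {s : Mem} (hs : s.Bounded M) (e : Expr) :
    e.cost s ≤ e.weight * (M.size + 1) ∧ (e.eval s).size ≤ e.weight * (M.size + 1) := by
  induction e with
  | lit c =>
    simp only [Expr.cost, Expr.eval, Expr.weight]
    constructor <;> nlinarith [Nat.zero_le (c.size * M.size), Nat.zero_le M.size]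
  | get x i ih =>
    have h := Nat.size_le_size (hs x (i.eval s))
    simp only [Expr.cost, Expr.eval, Expr.weight, add_mul]
    omega
  | op o e f he hf =>
    have h := o.size_eval_le (e.eval s) (f.eval s)
    simp only [Expr.cost, Expr.eval, Expr.weight, add_mul, mul_add, mul_assoc] at *
    omega

/-! ### Frame conditions -/

/-- Whether a program contains a write instruction for the array `y`. -/
def Cmd.mods : Cmd → ℕ → Bool
  | .skip, _ => false
  | .write x _ _, y => x == y
  | .seq p q, y => p.mods y || q.mods y
  | .ite _ p q, y => p.mods y || q.mods y
  | .loop _ p, y => p.mods y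

/-- The memories `s` and `s'` agree on the arrays that `p` does not modify. -/
def Frame (p : Cmd) (s s' : Mem) : Prop := ∀ y, p.mods y = false → s' y = s y

theorem Frame.refl (p : Cmd) (s : Mem) : Frame p s s := fun _ _ => rfl

theorem Frame.trans {p : Cmd} {s s' s'' : Mem} (h : Frame p s s') (h' : Frame p s' s'') :
    Frame p s s'' := fun y hy => (h' y hy).trans (h y hy)

/-- `Cmd.mods` depends on the text only, so for a concrete program and array the side condition is
`rfl`. The rule of consequence hands out the frame, and specifications need only speak of the arrays
that are written. -/
theorem Exec.frame {p : Cmd} {s s' : Mem} {t : ℕ} (h : Exec p s t s') : Frame p s s' := by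
  induction h with
  | skip s => exact Frame.refl _ _
  | write x i e s =>
    intro y hy
    have hxy : x ≠ y := by simpa [Cmd.mods] using hy
    exact Mem.write_of_ne _ _ _ hxy.symm
  | seq _ _ ihp ihq =>
    intro y hy
    simp only [Cmd.mods, Bool.or_eq_false_iff] at hy
    exact (ihq y hy.2).trans (ihp y hy.1)
  | ite_true _ _ ih =>
    intro y hy
    simp only [Cmd.mods, Bool.or_eq_false_iff] at hy
    exact ih y hy.1
  | ite_false _ _ ih =>
    intro y hy
    simp only [Cmd.mods, Bool.or_eq_false_iff] at hy
    exact ih y hy.2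
  | loop_done => exact Frame.refl _ _
  | loop_step _ _ _ ihp ihl =>
    intro y hy
    exact (ihl y hy).trans (ihp y hy)

/-! ### Total correctness with running times -/

/-- Started in the memory `s`, which may be assumed to be bounded by `M`, the program `p` halts
within time `T` in a memory that is again bounded by `M` and satisfies `Q`. -/
def Runs (M T : ℕ) (p : Cmd) (Q : Mem → Prop) (s : Mem) : Prop :=
  s.Bounded M → ∃ t s', Exec p s t s' ∧ t ≤ T ∧ s'.Bounded M ∧ Q s'

section Runs

variable {M T T' : ℕ} {p q : Cmd} {e : Expr} {Q Q' : Mem → Prop} {s : Mem}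

theorem Runs.bounded (h : s.Bounded M → Runs M T p Q s) : Runs M T p Q s := fun hs => h hs hs

theorem Runs.mono (h : Runs M T p Q s) (hT : T ≤ T')
    (hQ : ∀ s', Frame p s s' → s'.Bounded M → Q s' → Q' s') : Runs M T' p Q' s := by
  intro hs
  obtain ⟨t, s', h1, h2, h3, h4⟩ := h hs
  exact ⟨t, s', h1, h2.trans hT, h3, hQ s' h1.frame h3 h4⟩

theorem Runs.skip (h : Q s) : Runs M 1 .skip Q s := fun hs =>
  ⟨1, s, .skip s, le_rfl, hs, h⟩

theorem Runs.write {x : ℕ} {i : Expr} (he : s.Bounded M → e.eval s ≤ M)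
    (h : Q (s.write x (i.eval s) (e.eval s))) :
    Runs M ((1 + i.weight + e.weight) * (M.size + 1)) (.write x i e) Q s := by
  intro hs
  refine ⟨_, _, .write x i e s, ?_, hs.write _ _ (he hs), h⟩
  have h1 := (i.cost_le hs).1
  have h2 := (e.cost_le hs).1
  simp only [add_mul] at *
  omega

theorem Runs.seq (h : Runs M T p (Runs M T' q Q) s) : Runs M (T + T') (.seq p q) Q s := by
  intro hs
  obtain ⟨t, s', h1, h2, h3, h4⟩ := h hs
  obtain ⟨t', s'', h1', h2', h3', h4'⟩ := h4 h3
  exact ⟨_, s'', .seq h1 h1', add_le_add h2 h2', h3', h4'⟩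

theorem Runs.ite (ht : e.eval s ≠ 0 → Runs M T p Q s) (hf : e.eval s = 0 → Runs M T' q Q s) :
    Runs M ((1 + e.weight) * (M.size + 1) + (T + T')) (.ite e p q) Q s := by
  intro hs
  have hc := (e.cost_le hs).1
  by_cases he : e.eval s = 0
  · obtain ⟨t, s', h1, h2, h3, h4⟩ := hf he hs
    refine ⟨_, s', .ite_false he h1, ?_, h3, h4⟩
    simp only [add_mul] at *
    omega
  · obtain ⟨t, s', h1, h2, h3, h4⟩ := ht he hs
    refine ⟨_, s', .ite_true he h1, ?_, h3, h4⟩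
    simp only [add_mul] at *
    omega

/-- A loop that is iterated `N` times, with an invariant `I` that depends on the iteration. -/
theorem Runs.loop (I : ℕ → Mem → Prop) (N : ℕ) (h0 : I 0 s)
    (hstep : ∀ j < N, ∀ s', Frame p s s' → I j s' →
      e.eval s' ≠ 0 ∧ Runs M T p (I (j + 1)) s')
    (hend : ∀ s', Frame p s s' → I N s' → e.eval s' = 0 ∧ Q s') :
    Runs M ((N + 1) * ((1 + e.weight) * (M.size + 1) + T)) (.loop e p) Q s := by
  -- Induction on the number `d` of remaining iterations, for all memories that satisfy the
  -- invariant; `d + 1` accounts for the final failing test.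
  have key : ∀ d j s', j + d = N → Frame p s s' → I j s' →
      Runs M ((d + 1) * ((1 + e.weight) * (M.size + 1) + T)) (.loop e p) Q s' := by
    intro d
    induction d with
    | zero =>
      intro j s' hj hf hI hs
      obtain rfl : j = N := by omega
      obtain ⟨he, hQ⟩ := hend s' hf hI
      refine ⟨_, s', .loop_done he, ?_, hs, hQ⟩
      have hc := (e.cost_le hs).1
      simp only [add_mul] at *
      omega
    | succ d ih =>
      intro j s' hj hf hI hs
      obtain ⟨he, hp⟩ := hstep j (by omega) s' hf hI
      obtain ⟨t, s₁, h1, h2, h3, h4⟩ := hp hs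
      obtain ⟨t', s₂, h1', h2', h3', h4'⟩ :=
        ih (j + 1) s₁ (by omega) (hf.trans h1.frame) h4 h3
      refine ⟨_, s₂, .loop_step he h1 h1', ?_, h3', h4'⟩
      have hc := (e.cost_le hs).1
      rw [add_mul (d + 1) 1, one_mul]
      simp only [add_mul 1] at *
      omega
  exact key N 0 s (by omega) (Frame.refl _ _) h0

end Runs

/-! ### Running times read off from the program text -/

/-- A bound for the running time of `p` if every execution of a loop has at most `R` iterations;
the number `W` stands for the length of the numbers in the memory. -/
def Cmd.bound (W R : ℕ) : Cmd → ℕ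
  | .skip => 1
  | .write _ i e => (1 + i.weight + e.weight) * W
  | .seq p q => p.bound W R + q.bound W R
  | .ite e p q => (1 + e.weight) * W + (p.bound W R + q.bound W R)
  | .loop e p => (R + 1) * ((1 + e.weight) * W + p.bound W R)

theorem Cmd.exists_bound_le (p : Cmd) : ∃ K d : ℕ, ∀ W R, 1 ≤ W →
    p.bound W R ≤ K * W * (R + 1) ^ d := by
  induction p with
  | skip => exact ⟨1, 0, fun W R hW => by simpa [Cmd.bound] using hW⟩
  | write x i e => exact ⟨1 + i.weight + e.weight, 0, fun W R hW => by simp [Cmd.bound]⟩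
  | seq p q hp hq =>
    obtain ⟨K, d, h⟩ := hp
    obtain ⟨K', d', h'⟩ := hq
    refine ⟨K + K', d + d', fun W R hW => ?_⟩
    have h1 : (R + 1) ^ d ≤ (R + 1) ^ (d + d') := Nat.pow_le_pow_right (by omega) (by omega)
    have h2 : (R + 1) ^ d' ≤ (R + 1) ^ (d + d') := Nat.pow_le_pow_right (by omega) (by omega)
    have h3 := (h W R hW).trans (Nat.mul_le_mul_left _ h1)
    have h4 := (h' W R hW).trans (Nat.mul_le_mul_left _ h2)
    simp only [Cmd.bound, add_mul]
    omega
  | ite e p q hp hq =>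
    obtain ⟨K, d, h⟩ := hp
    obtain ⟨K', d', h'⟩ := hq
    refine ⟨(1 + e.weight) + (K + K'), d + d', fun W R hW => ?_⟩
    have h0 : 1 ≤ (R + 1) ^ (d + d') := Nat.one_le_pow _ _ (by omega)
    have h1 : (R + 1) ^ d ≤ (R + 1) ^ (d + d') := Nat.pow_le_pow_right (by omega) (by omega)
    have h2 : (R + 1) ^ d' ≤ (R + 1) ^ (d + d') := Nat.pow_le_pow_right (by omega) (by omega)
    have h3 := (h W R hW).trans (Nat.mul_le_mul_left _ h1)
    have h4 := (h' W R hW).trans (Nat.mul_le_mul_left _ h2)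
    have h5 := Nat.mul_le_mul_left ((1 + e.weight) * W) h0
    rw [mul_one] at h5
    rw [add_mul _ (K + K'), add_mul K, add_mul _ (K * W + K' * W), add_mul (K * W)]
    simp only [Cmd.bound]
    omega
  | loop e p hp =>
    obtain ⟨K, d, h⟩ := hp
    refine ⟨(1 + e.weight) + K, d + 1, fun W R hW => ?_⟩
    have h0 : 1 ≤ (R + 1) ^ d := Nat.one_le_pow _ _ (by omega)
    have h3 := h W R hW
    have h5 := Nat.mul_le_mul_left ((1 + e.weight) * W) h0
    rw [mul_one] at h5
    rw [pow_succ, ← mul_assoc, mul_comm]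
    simp only [Cmd.bound]
    apply Nat.mul_le_mul_left
    rw [add_mul _ K, add_mul _ (K * W)]
    omega

/-- Weakest preconditions for programs all of whose loops have at most `R` iterations. -/
def wp (M R : ℕ) (p : Cmd) (Q : Mem → Prop) (s : Mem) : Prop :=
  Runs M (p.bound (M.size + 1) R) p Q s

section wp

variable {M R : ℕ} {p q : Cmd} {e : Expr} {Q Q' : Mem → Prop} {s : Mem}

theorem wp_bounded (h : s.Bounded M → wp M R p Q s) : wp M R p Q s := Runs.bounded h

theorem wp_mono (h : wp M R p Q s)
    (hQ : ∀ s', Frame p s s' → s'.Bounded M → Q s' → Q' s') : wp M R p Q' s :=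
  Runs.mono h le_rfl hQ

theorem wp_skip (h : Q s) : wp M R .skip Q s := Runs.skip h

theorem wp_write {x : ℕ} {i : Expr} (he : s.Bounded M → e.eval s ≤ M)
    (h : Q (s.write x (i.eval s) (e.eval s))) : wp M R (.write x i e) Q s := Runs.write he h

theorem wp_seq (h : wp M R p (wp M R q Q) s) : wp M R (.seq p q) Q s := Runs.seq h

theorem wp_ite (ht : e.eval s ≠ 0 → wp M R p Q s) (hf : e.eval s = 0 → wp M R q Q s) :
    wp M R (.ite e p q) Q s := Runs.ite ht hf

/-- The only rule that uses `R`: the true number of iterations is forgotten in favour of the uniform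
bound, so the time no longer appears in the specifications. -/
theorem wp_loop (I : ℕ → Mem → Prop) (N : ℕ) (hN : N ≤ R) (h0 : I 0 s)
    (hstep : ∀ j < N, ∀ s', Frame p s s' → I j s' → e.eval s' ≠ 0 ∧ wp M R p (I (j + 1)) s')
    (hend : ∀ s', Frame p s s' → I N s' → e.eval s' = 0 ∧ Q s') :
    wp M R (.loop e p) Q s :=
  Runs.mono (Runs.loop I N h0 hstep hend) (Nat.mul_le_mul_right _ (by omega)) fun _ _ _ h => h

end wp

/-! ### Counting loops and sums -/

/-- The loop in which the cell `0` of the array `x` runs from `0` to the value of `e`. -/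
def forLoop (x : ℕ) (e : Expr) (p : Cmd) : Cmd :=
  .seq (.write x 0 0)
    (.loop (.op .lt (.get x 0) e) (.seq p (.write x 0 (.get x 0 + 1))))

theorem forLoop_mods (x : ℕ) (e : Expr) (p : Cmd) (y : ℕ) :
    (forLoop x e p).mods y = false ↔ x ≠ y ∧ p.mods y = false := by
  simp [forLoop, Cmd.mods]
  tauto

section forLoop

variable {M R x N : ℕ} {p : Cmd} {e : Expr} {Q : Mem → Prop} {s : Mem}

/-- The rule for `for` loops with its hypotheses on the running time of the body in general form. -/
theorem Runs.forLoop {T : ℕ} (I : ℕ → Mem → Prop) (hNM : N ≤ M)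
    (hx : p.mods x = false) (he : ∀ s', Frame (forLoop x e p) s s' → e.eval s' = N)
    (h0 : I 0 s)
    (hstep : ∀ j < N, ∀ s', Frame (RAM.forLoop x e p) s s' → s' x 0 = j → I j s' →
      Runs M T p (I (j + 1)) s')
    (hend : ∀ s', Frame (RAM.forLoop x e p) s s' → I N s' → Q s')
    (hI : ∀ j s' v, I j s' → I j (s'.write x 0 v)) :
    Runs M ((3 + 2 * e.weight + 20) * (N + 2) * (M.size + 1) + (N + 1) * T)
      (RAM.forLoop x e p) Q s := by
  have hmods := forLoop_mods x e p
  have hcomb : ∀ s' , Frame (.seq p (.write x 0 (.get x 0 + 1))) (s.write x 0 0) s' →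
      Frame (RAM.forLoop x e p) s s' := by
    intro s' h y hy
    rw [h y (by simpa [Cmd.mods, and_comm] using (hmods y).1 hy)]
    exact Mem.write_of_ne _ _ _ ((hmods y).1 hy).1.symm
  refine Runs.mono (Runs.seq (Runs.write (fun _ => by simp)
    (Runs.loop (fun j s' => s' x 0 = j ∧ I j s') N ⟨by simp, hI _ _ _ h0⟩
      (T := T + (1 + (0 : Expr).weight + (Expr.get x 0 + 1).weight) * (M.size + 1)) ?_
      (Q := Q) ?_))) ?_ fun _ _ _ h => h
  · rintro j hj s' hf ⟨hxj, hIj⟩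
    have hf' := hcomb s' hf
    refine ⟨by simp [hxj, he s' hf', hj], Runs.seq ?_⟩
    refine Runs.mono (hstep j hj s' hf' hxj hIj) le_rfl fun s₂ hf₂ _ hI₂ => ?_
    have hxj₂ : s₂ x 0 = j := by rw [hf₂ x hx, hxj]
    refine Runs.write (fun _ => ?_) ?_
    · simp only [Expr.eval_add, Expr.eval_get, Expr.eval_zero, Expr.eval_one, hxj₂]
      omega
    · exact ⟨by simp [hxj₂], hI _ _ _ hI₂⟩
  · rintro s' hf ⟨hxj, hIj⟩
    exact ⟨by simp [hxj, he s' (hcomb s' hf)], hend s' (hcomb s' hf) hIj⟩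
  · have hw0 : (0 : Expr).weight = 1 := rfl
    have hw1 : (Expr.get x 0 + 1).weight = 10 := rfl
    have hw2 : (Expr.op .lt (.get x 0) e).weight = 2 * (2 + e.weight + 1) := rfl
    rw [hw0, hw1, hw2]
    generalize M.size + 1 = W
    -- With `w` the weight of `e`, test and increment cost `2 * w + 19` units of `W` per iteration
    -- and the initial write costs `3`; the constant `2 * w + 23` is generous.
    nlinarith [Nat.zero_le (N * W), Nat.zero_le W, Nat.zero_le (e.weight * W)]

/-- The rule keeps track of the counter itself, so `I` only has to be insensitive to writes to the
counter cell, which is `hI`. -/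
theorem wp_forLoop (I : ℕ → Mem → Prop) (hNR : N ≤ R) (hNM : N ≤ M)
    (hx : p.mods x = false) (he : ∀ s', Frame (forLoop x e p) s s' → e.eval s' = N)
    (h0 : I 0 s)
    (hstep : ∀ j < N, ∀ s', Frame (forLoop x e p) s s' → s' x 0 = j → I j s' →
      wp M R p (I (j + 1)) s')
    (hend : ∀ s', Frame (forLoop x e p) s s' → I N s' → Q s')
    (hI : ∀ j s' v, I j s' → I j (s'.write x 0 v)) :
    wp M R (forLoop x e p) Q s := by
  have hmods := forLoop_mods x e p
  have hcomb : ∀ s' , Frame (.seq p (.write x 0 (.get x 0 + 1))) (s.write x 0 0) s' →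
      Frame (forLoop x e p) s s' := by
    intro s' h y hy
    rw [h y (by simpa [Cmd.mods, and_comm] using (hmods y).1 hy)]
    exact Mem.write_of_ne _ _ _ ((hmods y).1 hy).1.symm
  refine wp_seq (wp_write (fun _ => by simp)
    (wp_loop (fun j s' => s' x 0 = j ∧ I j s') N hNR ⟨by simp, hI _ _ _ h0⟩ ?_ ?_))
  · rintro j hj s' hf ⟨hxj, hIj⟩
    have hf' := hcomb s' hf
    refine ⟨by simp [hxj, he s' hf', hj], wp_seq ?_⟩
    refine wp_mono (hstep j hj s' hf' hxj hIj) fun s₂ hf₂ _ hI₂ => ?_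
    have hxj₂ : s₂ x 0 = j := by rw [hf₂ x hx, hxj]
    refine wp_write (fun _ => ?_) ?_
    · simp only [Expr.eval_add, Expr.eval_get, Expr.eval_zero, Expr.eval_one, hxj₂]
      omega
    · exact ⟨by simp [hxj₂], hI _ _ _ hI₂⟩
  · rintro s' hf ⟨hxj, hIj⟩
    exact ⟨by simp [hxj, he s' (hcomb s' hf)], hend s' (hcomb s' hf) hIj⟩

end forLoop

/-- Computes in the cell `0` of the array `acc` the sum of the values of `f` while the cell `0` of
the array `x` runs from `0` to the value of `e`. -/
def sumLoop (x acc : ℕ) (e f : Expr) : Cmd :=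
  .seq (.write acc 0 0) (forLoop x e (.write acc 0 (.get acc 0 + f)))

theorem wp_sumLoop {M R x acc N : ℕ} {e f : Expr} {Q : Mem → Prop} {s : Mem} {F : ℕ → ℕ}
    (hNR : N ≤ R) (hNM : N ≤ M) (hx : acc ≠ x)
    (he : ∀ s', Frame (sumLoop x acc e f) s s' → e.eval s' = N)
    (hf : ∀ j < N, ∀ s', Frame (sumLoop x acc e f) s s' → s' x 0 = j → f.eval s' = F j)
    (hM : ∑ j ∈ Finset.range N, F j ≤ M)
    (hQ : ∀ s', Frame (sumLoop x acc e f) s s' →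
      s' acc 0 = ∑ j ∈ Finset.range N, F j → Q s') :
    wp M R (sumLoop x acc e f) Q s := by
  have hcomb : ∀ s', Frame (forLoop x e (.write acc 0 (.get acc 0 + f))) (s.write acc 0 0) s' →
      Frame (sumLoop x acc e f) s s' := by
    intro s' h y hy
    have hy' : acc ≠ y ∧ (forLoop x e (.write acc 0 (.get acc 0 + f))).mods y = false := by
      simpa [sumLoop, Cmd.mods] using hy
    rw [h y hy'.2]
    exact Mem.write_of_ne _ _ _ hy'.1.symm
  refine wp_seq (wp_write (fun _ => by simp) (wp_forLoop
    (fun j s' => s' acc 0 = ∑ i ∈ Finset.range j, F i) hNR hNM ?_ ?_ ?_ ?_ ?_ ?_))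
  · simpa [Cmd.mods] using hx
  · exact fun s' h => he s' (hcomb s' h)
  · simp
  · intro j hj s' h hxj hI
    have hfj := hf j hj s' (hcomb s' h) hxj
    refine wp_write (fun _ => ?_) ?_
    -- Partial sums of natural numbers stay below the full sum, so `hM` alone keeps the accumulator
    -- in range.
    · have hle : ∑ i ∈ Finset.range (j + 1), F i ≤ ∑ i ∈ Finset.range N, F i :=
        Finset.sum_le_sum_of_subset (Finset.range_subset_range.2 hj)
      rw [Finset.sum_range_succ] at hle
      simp only [Expr.eval_add, Expr.eval_get, Expr.eval_zero, hI, hfj]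
      omega
    · simp [hI, hfj, Finset.sum_range_succ]
  · exact fun s' h hI => hQ s' (hcomb s' h) hI
  · intro j s' v h
    simpa [hx] using h

theorem wp_sumLoop_fin {M R x acc N : ℕ} {e f : Expr} {Q : Mem → Prop} {s : Mem} {F : Fin N → ℕ}
    (hNR : N ≤ R) (hNM : N ≤ M) (hx : acc ≠ x)
    (he : ∀ s', Frame (sumLoop x acc e f) s s' → e.eval s' = N)
    (hf : ∀ j : Fin N, ∀ s', Frame (sumLoop x acc e f) s s' → s' x 0 = j → f.eval s' = F j)
    (hM : ∑ j, F j ≤ M)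
    (hQ : ∀ s', Frame (sumLoop x acc e f) s s' → s' acc 0 = ∑ j, F j → Q s') :
    wp M R (sumLoop x acc e f) Q s := by
  have hsum : ∑ j ∈ Finset.range N, (if h : j < N then F ⟨j, h⟩ else 0) = ∑ j, F j := by
    rw [Finset.sum_range]
    simp
  refine wp_sumLoop hNR hNM hx he (F := fun j => if h : j < N then F ⟨j, h⟩ else 0) ?_
    (hsum.trans_le hM) fun s' h1 h2 => hQ s' h1 (h2.trans hsum)
  intro j hj s' h1 h2
  rw [hf ⟨j, hj⟩ s' h1 h2, dif_pos hj]

end RAM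

/-! ### The combinatorics of the algorithm -/

namespace HouseAllocation

/-! ### Minimum cost assignment by an auction -/

section Auction

/-- The state of an auction in which the bidders `a < n` compete for the houses `h < m` at the
costs `c a h`: the bidder `a` holds the house `A a - 1`, or none if `A a = 0`, and `p` holds the
prices. All holders are content up to one unit, and prices are at most `B + 1`. -/
structure AuctionInv (n m B : ℕ) (c : ℕ → ℕ → ℕ) (A p : ℕ → ℕ) : Prop where
  le : ∀ a < n, A a ≤ m
  inj : ∀ a < n, ∀ b < n, A a ≠ 0 → A a = A b → a = b
  held : ∀ h < m, p h ≠ 0 → ∃ a < n, A a = h + 1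
  content : ∀ a < n, ∀ h < m, ∀ h' < m, A a = h + 1 → c a h + p h ≤ c a h' + p h' + 1
  price_le : ∀ h < m, p h ≤ B + 1

variable {n m B : ℕ} {c : ℕ → ℕ → ℕ} {A p : ℕ → ℕ}

theorem AuctionInv.init : AuctionInv n m B c (fun _ => 0) (fun _ => 0) where
  le := by simp
  inj := by simp
  held := by simp
  content := by simp
  price_le := by simp

theorem AuctionInv.congr {A' p' : ℕ → ℕ} (hI : AuctionInv n m B c A p)
    (hA : ∀ a < n, A' a = A a) (hp : ∀ h < m, p' h = p h) : AuctionInv n m B c A' p' where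
  le a ha := by rw [hA a ha]; exact hI.le a ha
  inj a ha b hb := by rw [hA a ha, hA b hb]; exact hI.inj a ha b hb
  held h hh h0 := by
    rw [hp h hh] at h0
    obtain ⟨a, ha, h1⟩ := hI.held h hh h0
    exact ⟨a, ha, by rw [hA a ha, h1]⟩
  content a ha h hh h' hh' := by
    rw [hA a ha, hp h hh, hp h' hh']
    exact hI.content a ha h hh h' hh'
  price_le h hh := by rw [hp h hh]; exact hI.price_le h hh

/-- If a bidder holds no house, then some house is held by nobody. -/
theorem AuctionInv.exists_free (hI : AuctionInv n m B c A p) (hnm : n ≤ m) {a : ℕ} (ha : a < n)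
    (h0 : A a = 0) : ∃ h < m, p h = 0 := by
  by_contra! hcon
  -- Otherwise all `m` houses are held by the `n - 1` bidders other than `a`, contradicting `n ≤ m`.
  have hsub : (Finset.range m).image (· + 1) ⊆ ((Finset.range n).erase a).image A := by
    intro x hx
    simp only [Finset.mem_image, Finset.mem_range] at hx
    obtain ⟨h, hh, rfl⟩ := hx
    obtain ⟨b, hb, hbh⟩ := hI.held h hh (hcon h hh)
    refine Finset.mem_image.2 ⟨b, ?_, hbh⟩
    simp only [Finset.mem_erase, Finset.mem_range]
    refine ⟨?_, hb⟩
    rintro rfl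
    omega
  have h1 := (Finset.card_le_card hsub).trans Finset.card_image_le
  rw [Finset.card_image_of_injective _ (add_left_injective 1),
    Finset.card_erase_of_mem (Finset.mem_range.2 ha), Finset.card_range, Finset.card_range] at h1
  omega

/-- A bid: the bidder `a`, who holds no house, takes the house that is cheapest for her from its
holder, and the price of the house is raised by one unit. -/
theorem AuctionInv.bid (hI : AuctionInv n m B c A p) (hnm : n ≤ m)
    (hB : ∀ a < n, ∀ h < m, c a h ≤ B) {a h : ℕ} (ha : a < n) (h0 : A a = 0) (hh : h < m)
    (hmin : ∀ h' < m, c a h + p h ≤ c a h' + p h') :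
    AuctionInv n m B c
      (fun b => if b = a then h + 1 else if A b = h + 1 then 0 else A b)
      (fun h' => if h' = h then p h + 1 else p h') where
  le b hb := by
    have := hI.le b hb
    split_ifs <;> omega
  inj b hb b' hb' := by
    have := hI.inj b hb b' hb'
    split_ifs with h1 h2 h3 h4 h5 <;> intro h6 h7 <;>
      first | exact h7.elim | omega
  held h' hh' hp := by
    by_cases hhh : h' = h
    · exact ⟨a, ha, by simp [hhh]⟩
    · simp only [hhh, if_false] at hp
      obtain ⟨b, hb, hbh⟩ := hI.held h' hh' hp
      refine ⟨b, hb, ?_⟩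
      have hba : b ≠ a := by
        rintro rfl
        omega
      have : A b ≠ h + 1 := by omega
      simp only [hba, if_false, this]
      exact hbh
  content b hb h₁ hh₁ h₂ hh₂ hA := by
    have h3 : p h₂ ≤ if h₂ = h then p h + 1 else p h₂ := by
      split_ifs with h4
      · rw [h4]; omega
      · exact le_rfl
    by_cases hba : b = a
    · simp only [hba, if_true] at hA
      obtain rfl : h = h₁ := by omega
      have := hmin h₂ hh₂
      simp only [if_true, hba]
      omega
    · simp only [hba, if_false] at hA
      split_ifs at hA with h5
      have := hI.content b hb h₁ hh₁ h₂ hh₂ hA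
      have : h₁ ≠ h := by
        rintro rfl
        exact h5 hA
      simp only [this, if_false]
      omega
  -- Since `a` is idle, some house has price `0` and is offered to her for at most `B`. Her cheapest
  -- offer is no worse, so `p h ≤ B` before the raise.
  price_le h' hh' := by
    obtain ⟨h₁, hh₁, hp⟩ := hI.exists_free hnm ha h0
    have h2 := hmin h₁ hh₁
    have h3 := hB a ha h₁ hh₁
    have h4 := hI.price_le h' hh'
    split_ifs <;> omega

theorem sum_price_bid {h : ℕ} (hh : h < m) :
    ∑ h' ∈ Finset.range m, (if h' = h then p h + 1 else p h')
      = ∑ h' ∈ Finset.range m, p h' + 1 := by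
  have h1 : ∀ h' ∈ Finset.range m, (if h' = h then p h + 1 else p h')
      = p h' + if h' = h then 1 else 0 := by
    intro h' _
    split_ifs with h2
    · rw [h2]
    · rfl
  rw [Finset.sum_congr rfl h1, Finset.sum_add_distrib]
  simp [hh]

theorem AuctionInv.sum_price_le (hI : AuctionInv n m B c A p) :
    ∑ h ∈ Finset.range m, p h ≤ m * (B + 1) := by
  have := Finset.sum_le_card_nsmul (Finset.range m) p (B + 1)
    fun h hh => hI.price_le h (Finset.mem_range.1 hh)
  simpa using this

/-- If all bidders hold a house, the resulting assignment is optimal up to `n` units. -/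
theorem AuctionInv.exists_assignment (hI : AuctionInv n m B c A p) (hA : ∀ a < n, A a ≠ 0) :
    ∃ φ : Fin n ↪ Fin m, (∀ a : Fin n, A a = φ a + 1) ∧
      ∀ ψ : Fin n ↪ Fin m, ∑ a : Fin n, c a (φ a) ≤ ∑ a : Fin n, c a (ψ a) + n := by
  have hlt : ∀ a : Fin n, A a - 1 < m := fun a => by
    have h1 := hI.le a a.2
    have h2 := hA a a.2
    omega
  have hφ : ∀ a : Fin n, A a = (⟨A a - 1, hlt a⟩ : Fin m) + 1 := fun a => by
    have h2 := hA a a.2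
    simp only
    omega
  let φ : Fin n ↪ Fin m := ⟨fun a => ⟨A a - 1, hlt a⟩, fun a b hab => by
    have h1 := hφ a
    have h2 := hφ b
    simp only [Fin.mk.injEq] at hab
    exact Fin.ext (hI.inj a a.2 b b.2 (hA a a.2) (by simp only at h1 h2; omega))⟩
  have hφA : ∀ a : Fin n, A a = φ a + 1 := hφ
  refine ⟨φ, hφA, fun ψ => ?_⟩
  -- Linear programming duality: summing the contentment conditions loses one unit per bidder. The
  -- prices then drop out, because `ψ` collects at most the sum of all prices, while `φ` collects
  -- exactly that sum, houses held by nobody having price `0`.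
  have h1 : ∑ a : Fin n, (c a (φ a) + p (φ a)) ≤ ∑ a : Fin n, (c a (ψ a) + p (ψ a) + 1) :=
    Finset.sum_le_sum fun a _ =>
      hI.content a a.2 (φ a) (φ a).2 (ψ a) (ψ a).2 (hφA a)
  have h2 : ∑ a, p (ψ a) ≤ ∑ h : Fin m, p h := by
    have : ∑ a, p (ψ a) = ∑ h ∈ Finset.univ.map ψ, p h := by rw [Finset.sum_map]
    rw [this]
    exact Finset.sum_le_sum_of_subset (Finset.subset_univ _)
  have h3 : ∑ a, p (φ a) = ∑ h : Fin m, p h := by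
    have : ∑ a, p (φ a) = ∑ h ∈ Finset.univ.map φ, p h := by rw [Finset.sum_map]
    rw [this]
    refine Finset.sum_subset (Finset.subset_univ _) fun h _ hh => ?_
    by_contra hp
    obtain ⟨a, ha, hah⟩ := hI.held h h.2 hp
    refine hh (Finset.mem_map.2 ⟨⟨a, ha⟩, Finset.mem_univ _, Fin.ext ?_⟩)
    have := hφA ⟨a, ha⟩
    simp only at this
    omega
  simp only [Finset.sum_add_distrib, Finset.sum_const, Finset.card_univ, Fintype.card_fin,
    smul_eq_mul, mul_one] at h1
  omega

end Auction

/-! ### Reduction of a guess to an assignment problem -/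

section Guess

theorem adj_mem_cover {A : Type*} {G : SimpleGraph A} {T : Finset A}
    (hT : G.IsVertexCover (T : Set A)) {a b : A} (hab : G.Adj a b) (ha : a ∉ T) : b ∈ T := by
  rcases hT hab with h | h
  · exact absurd h ha
  · exact h

variable {A H : Type*} [Fintype A]

open scoped Classical in
/-- The cost of giving the house `h` to the agent `a` if the agents `s` of the vertex cover `T`
shall receive the houses `x s` and only those with `e s` may become envious. -/
noncomputable def guessCost (G : SimpleGraph A) (P : A → Finset H) (T : Finset A) (x : A → H)
    (e : A → Prop) (a : A) (h : H) : ℕ :=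
  if a ∈ T then (if x a = h then 0 else Fintype.card A + 1)
  else (Fintype.card A + 1) * (Finset.univ.filter fun s =>
      s ∈ T ∧ G.Adj a s ∧ ¬e s ∧ x s ∉ P s ∧ h ∈ P s).card +
    if (∃ s ∈ T, G.Adj a s ∧ x s ∈ P a) ∧ h ∉ P a then 1 else 0

/-- The agent `a` is envious under `φ`. -/
def Envious (G : SimpleGraph A) (P : A → Finset H) (φ : A ↪ H) (a : A) : Prop :=
  φ a ∉ P a ∧ ∃ b, G.Adj a b ∧ φ b ∈ P a

open scoped Classical in
theorem envy_eq_card (G : SimpleGraph A) (P : A → Finset H) (φ : A ↪ H) :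
    envy G P φ = (Finset.univ.filter (Envious G P φ)).card := by
  rw [envy, ← Set.ncard_coe_finset]
  congr 1
  ext a
  simp only [envySet, Envious, Set.Nonempty, Set.mem_ofPred_eq, Finset.coe_filter,
    Finset.mem_univ, true_and]
  constructor
  · rintro ⟨b, h1, h2, h3⟩
    exact ⟨h2, b, h1, h3⟩
  · rintro ⟨h2, b, h1, h3⟩
    exact ⟨b, h1, h2, h3⟩

theorem envy_le_card (G : SimpleGraph A) (P : A → Finset H) (φ : A ↪ H) :
    envy G P φ ≤ Fintype.card A := by
  classical
  rw [envy_eq_card]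
  exact Finset.card_le_univ _

variable {G : SimpleGraph A} {P : A → Finset H} {T : Finset A} {x : A → H} {e : A → Prop}

open scoped Classical in
/-- The cost of an allocation that agrees with the guess is the number of envious agents outside
the vertex cover. -/
theorem guessCost_of_agree (hT : G.IsVertexCover (T : Set A)) {ψ : A ↪ H}
    (hx : ∀ a ∈ T, x a = ψ a)
    (he : ∀ a ∉ T, ∀ s ∈ T, G.Adj a s → ¬e s → ψ s ∉ P s → ψ a ∉ P s) (a : A) :
    guessCost G P T x e a (ψ a) = if a ∉ T ∧ Envious G P ψ a then 1 else 0 := by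
  unfold guessCost
  by_cases ha : a ∈ T
  · simp [ha, hx a ha]
  · have h1 : (Finset.univ.filter fun s =>
        s ∈ T ∧ G.Adj a s ∧ ¬e s ∧ x s ∉ P s ∧ ψ a ∈ P s).card = 0 := by
      rw [Finset.card_eq_zero, Finset.filter_eq_empty_iff]
      rintro s - ⟨h1, h2, h3, h4, h5⟩
      exact he a ha s h1 h2 h3 (hx s h1 ▸ h4) h5
    -- All neighbours of `a ∉ T` lie in `T`, where the guess already tells their houses.
    have h2 : ((∃ s ∈ T, G.Adj a s ∧ x s ∈ P a) ∧ ψ a ∉ P a) ↔ Envious G P ψ a := by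
      constructor
      · rintro ⟨⟨s, hs, h3, h4⟩, h5⟩
        exact ⟨h5, s, h3, hx s hs ▸ h4⟩
      · rintro ⟨h5, s, h3, h4⟩
        have hs := adj_mem_cover hT h3 ha
        exact ⟨⟨s, hs, h3, by rw [hx s hs]; exact h4⟩, h5⟩
    rw [if_neg ha, h1]
    simp only [h2, ha, not_false_eq_true, true_and, mul_zero, zero_add]

/-- A single violation of the guess costs at least `n + 1`, which the hypothesis excludes. -/
theorem agree_of_guessCost_le {φ : A ↪ H}
    (h : ∀ a, guessCost G P T x e a (φ a) ≤ Fintype.card A) :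
    (∀ a ∈ T, x a = φ a) ∧
      ∀ a ∉ T, ∀ s ∈ T, G.Adj a s → ¬e s → φ s ∉ P s → φ a ∉ P s := by
  classical
  have hx : ∀ a ∈ T, x a = φ a := by
    intro a ha
    have h1 := h a
    by_contra hne
    simp [guessCost, ha, hne] at h1
  refine ⟨hx, fun a ha s hs h1 h2 h3 h4 => ?_⟩
  have h5 := h a
  have h6 : 1 ≤ (Finset.univ.filter fun s =>
      s ∈ T ∧ G.Adj a s ∧ ¬e s ∧ x s ∉ P s ∧ φ a ∈ P s).card := by
    rw [Nat.one_le_iff_ne_zero, Finset.card_ne_zero]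
    refine ⟨s, ?_⟩
    simp only [Finset.mem_filter, Finset.mem_univ, true_and]
    exact ⟨hs, h1, h2, by rw [hx s hs]; exact h3, h4⟩
  rw [guessCost, if_neg ha] at h5
  have := Nat.mul_le_mul_left (Fintype.card A + 1) h6
  omega

/-- If the guess agrees with `ψ` and `φ` is no more expensive than `ψ`, then `φ` has no more
envious agents than `ψ`. -/
theorem envy_le_of_guessCost_le (hT : G.IsVertexCover (T : Set A)) {φ ψ : A ↪ H}
    (hx : ∀ a ∈ T, x a = ψ a) (he : ∀ a ∈ T, e a ↔ Envious G P ψ a)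
    (hle : ∑ a, guessCost G P T x e a (φ a) ≤ ∑ a, guessCost G P T x e a (ψ a)) :
    envy G P φ ≤ envy G P ψ := by
  classical
  have hψ : ∀ a ∉ T, ∀ s ∈ T, G.Adj a s → ¬e s → ψ s ∉ P s → ψ a ∉ P s :=
    fun a _ s hs h1 h2 h3 h4 => h2 ((he s hs).2 ⟨h3, a, h1.symm, h4⟩)
  have hcψ : ∑ a, guessCost G P T x e a (ψ a)
      = (Finset.univ.filter fun a => a ∉ T ∧ Envious G P ψ a).card := by
    rw [Finset.card_filter]
    exact Finset.sum_congr rfl fun a _ => guessCost_of_agree hT hx hψ a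
  -- The cost of `ψ` counts agents, so it is at most `n`; being no more expensive, `φ` cannot afford
  -- any penalty.
  have hcard : ∑ a, guessCost G P T x e a (φ a) ≤ Fintype.card A := by
    rw [hcψ] at hle
    exact hle.trans (Finset.card_le_univ _)
  obtain ⟨hxφ, hφ⟩ := agree_of_guessCost_le (φ := φ) fun a =>
    (Finset.single_le_sum (f := fun a => guessCost G P T x e a (φ a))
      (fun _ _ => Nat.zero_le _) (Finset.mem_univ a)).trans hcard
  have hcφ : ∑ a, guessCost G P T x e a (φ a)
      = (Finset.univ.filter fun a => a ∉ T ∧ Envious G P φ a).card := by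
    rw [Finset.card_filter]
    exact Finset.sum_congr rfl fun a _ => guessCost_of_agree hT hxφ hφ a
  have hsplit : ∀ χ : A ↪ H, envy G P χ
      = (Finset.univ.filter fun a => a ∉ T ∧ Envious G P χ a).card
        + (Finset.univ.filter fun a => a ∈ T ∧ Envious G P χ a).card := by
    intro χ
    rw [envy_eq_card, ← Finset.card_filter_add_card_filter_not (fun a => a ∉ T),
      Finset.filter_filter, Finset.filter_filter]
    simp only [not_not, and_comm]
  -- Envy of a cover agent towards another cover agent is the same under `φ` and `ψ`, which coincide
  -- on `T`. Envy towards an outside agent is penalised unless flagged, and the flagged agents are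
  -- exactly those envious under `ψ`.
  have hsub : (Finset.univ.filter fun a => a ∈ T ∧ Envious G P φ a)
      ⊆ Finset.univ.filter fun a => a ∈ T ∧ Envious G P ψ a := by
    intro s
    simp only [Finset.mem_filter, Finset.mem_univ, true_and]
    rintro ⟨hs, h1, a, h2, h3⟩
    refine ⟨hs, ?_⟩
    have hsφψ : φ s = ψ s := (hxφ s hs).symm.trans (hx s hs)
    by_cases ha : a ∈ T
    · have haφψ : φ a = ψ a := (hxφ a ha).symm.trans (hx a ha)
      exact ⟨hsφψ ▸ h1, a, h2, haφψ ▸ h3⟩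
    · by_contra hne
      exact hφ a ha s hs h2.symm (fun h => hne ((he s hs).1 h)) h1 h3
  have := Finset.card_le_card hsub
  rw [hsplit, hsplit]
  omega

/-- After multiplication by `n + 1` this gives the cost bound `(n + 1) ^ 3` that enters the number
of auction rounds. -/
theorem guessCost_le (a : A) (h : H) :
    guessCost G P T x e a h ≤ (Fintype.card A + 1) * (Fintype.card A + 1) := by
  classical
  have h1 := Nat.mul_le_mul_left (Fintype.card A + 1) (Finset.card_le_univ
    (Finset.univ.filter fun s => s ∈ T ∧ G.Adj a s ∧ ¬e s ∧ x s ∉ P s ∧ h ∈ P s))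
  have h2 : (Fintype.card A + 1) * (Fintype.card A + 1)
    = (Fintype.card A + 1) * Fintype.card A + (Fintype.card A + 1) := by ring
  unfold guessCost
  split_ifs <;> omega

end Guess

/-! ### Sets and guesses coded by digits -/

section Codes

/-- The agents named by the digits of `g` in base `b`, among the first `n` digits. -/
def CodeMem (n b g : ℕ) (i : ℕ) : Prop := ∃ j < n, g / b ^ j % b = i

/-- Every set of `k` agents is coded by a number below `b ^ k`. -/
theorem exists_code {n b : ℕ} (hb : 2 ≤ b) (hn : n < b) (S : Finset (Fin n)) :
    ∃ g < b ^ S.card, ∀ a : Fin n, CodeMem n b g (a + 1) ↔ a ∈ S := by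
  -- Naming `a` by `a + 1` lets the digit `0` name nobody. This takes care of positions beyond the
  -- list, and it makes the last digit nonzero, as recovering the list from its value requires.
  set L : List ℕ := S.toList.map fun a : Fin n => (a : ℕ) + 1 with hL
  have hlen : L.length = S.card := by simp [hL]
  have hlt : ∀ l ∈ L, l < b := by
    intro l hl
    simp only [hL, List.mem_map] at hl
    obtain ⟨a, -, rfl⟩ := hl
    have := a.2
    omega
  have h0 : ∀ l ∈ L, l ≠ 0 := by
    intro l hl
    simp only [hL, List.mem_map] at hl
    obtain ⟨a, -, rfl⟩ := hl
    omega
  have hdig : Nat.digits b (Nat.ofDigits b L) = L :=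
    Nat.digits_ofDigits b (by omega) L hlt fun h => h0 _ (List.getLast_mem h)
  have hget : ∀ j, Nat.ofDigits b L / b ^ j % b = L.getD j 0 := by
    intro j
    rw [← Nat.getD_digits _ _ hb, hdig]
  refine ⟨Nat.ofDigits b L, ?_, fun a => ?_⟩
  · rw [← hlen]
    exact Nat.ofDigits_lt_base_pow_length (by omega) hlt
  · have hmem : a ∈ S ↔ (a : ℕ) + 1 ∈ L := by
      simp [hL, Fin.val_inj]
    rw [hmem, List.mem_iff_getElem]
    constructor
    · rintro ⟨j, -, hj⟩
      rw [hget] at hj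
      by_cases hjl : j < L.length
      · exact ⟨j, hjl, by rw [← hj, List.getD_eq_getElem _ _ hjl]⟩
      · rw [List.getD_eq_default _ _ (by omega)] at hj
        omega
    · rintro ⟨j, hj, hja⟩
      refine ⟨j, ?_, ?_⟩
      · have := S.card_le_univ
        rw [Fintype.card_fin] at this
        omega
      · rw [hget, List.getD_eq_getElem _ _ hj, hja]

open scoped Classical in
-- From position `k` on all digits of `g` are `0`, which is not of the form `a + 1`; so every named
-- agent uses one of the first `k` positions.
theorem card_code_le {n b g k : ℕ} (hg : g < b ^ k) :
    (Finset.univ.filter fun a : Fin n => CodeMem n b g (a + 1)).card ≤ k := by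
  have hsub : (Finset.univ.filter fun a : Fin n => CodeMem n b g (a + 1)).image
      (fun a : Fin n => (a : ℕ) + 1) ⊆ (Finset.range k).image fun j => g / b ^ j % b := by
    intro i hi
    simp only [Finset.mem_image, Finset.mem_filter, Finset.mem_univ, true_and] at hi
    obtain ⟨a, ⟨j, -, hj⟩, rfl⟩ := hi
    refine Finset.mem_image.2 ⟨j, Finset.mem_range.2 ?_, hj⟩
    by_contra hjk
    rcases Nat.eq_zero_or_pos b with rfl | hb
    · rcases Nat.eq_zero_or_pos k with rfl | hk
      · have : g = 0 := by simpa using hg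
        simp [this] at hj
      · rw [zero_pow (by omega)] at hg
        omega
    · rw [Nat.div_eq_of_lt (hg.trans_le (Nat.pow_le_pow_right hb (by omega)))] at hj
      simp at hj
  have h1 := (Finset.card_le_card hsub).trans Finset.card_image_le
  rw [Finset.card_image_of_injective _ fun a b hab => Fin.ext (by simpa using hab),
    Finset.card_range] at h1
  exact h1

/-- Numbers in a mixed radix representation, in which the digits not in use have radix `1`. -/
theorem exists_digits {b : ℕ} (hb : 0 < b) (C : ℕ → Prop) [DecidablePred C] (f : ℕ → ℕ)
    (hf : ∀ a, f a < b) (n : ℕ) :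
    ∃ g < ∏ i ∈ Finset.range n, (if C i then b else 1),
      ∀ a < n, C a → g / (∏ i ∈ Finset.range a, (if C i then b else 1)) % b = f a := by
  have hpos : ∀ n, 0 < ∏ i ∈ Finset.range n, (if C i then b else 1) := fun n =>
    Finset.prod_pos fun i _ => by split_ifs <;> omega
  induction n with
  | zero => exact ⟨0, by simp, by simp⟩
  | succ n ih =>
    obtain ⟨g, hg, hgd⟩ := ih
    by_cases hn : C n
    · refine ⟨g + (∏ i ∈ Finset.range n, (if C i then b else 1)) * f n, ?_, ?_⟩
      · rw [Finset.prod_range_succ, if_pos hn]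
        have := Nat.mul_le_mul_left (∏ i ∈ Finset.range n, (if C i then b else 1))
          (Nat.succ_le_of_lt (hf n))
        rw [Nat.succ_eq_add_one, mul_add, mul_one] at this
        omega
      · intro a ha hCa
        rcases Nat.lt_succ_iff_lt_or_eq.1 ha with ha | rfl
        -- The place value of the new digit is a multiple of `b` times that of `a`, so adding a
        -- multiple of it leaves the digit of `a` unchanged.
        · obtain ⟨q, hq⟩ : ∃ q, ∏ i ∈ Finset.range n, (if C i then b else 1)
              = (∏ i ∈ Finset.range a, (if C i then b else 1)) * b * q := by
            have h1 : ∏ i ∈ Finset.range (a + 1), (if C i then b else 1) ∣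
                ∏ i ∈ Finset.range n, (if C i then b else 1) :=
              Finset.prod_dvd_prod_of_subset _ _ _ (Finset.range_subset_range.2 ha)
            rw [Finset.prod_range_succ, if_pos hCa] at h1
            exact h1
          rw [hq, mul_assoc, mul_assoc, Nat.add_mul_div_left _ _ (hpos a),
            Nat.add_mul_mod_self_left]
          exact hgd a ha hCa
        · rw [Nat.add_mul_div_left _ _ (hpos a), Nat.div_eq_of_lt hg, zero_add,
            Nat.mod_eq_of_lt (hf a)]
    · refine ⟨g, ?_, ?_⟩
      · rw [Finset.prod_range_succ, if_neg hn, mul_one]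
        exact hg
      · intro a ha hCa
        rcases Nat.lt_succ_iff_lt_or_eq.1 ha with ha | rfl
        · exact hgd a ha hCa
        · exact absurd hCa hn

end Codes

end HouseAllocation

/-! ### The program -/

namespace HouseAllocation

open RAM

local notation "dimArr" => 0
local notation "adjArr" => 1
local notation "prefArr" => 2
local notation "outArr" => 3
local notation "bestVar" => 4
local notation "codeVar" => 5
local notation "covArr" => 6
local notation "remVar" => 7
local notation "iVar" => 8
local notation "jVar" => 9
local notation "badVar" => 10
local notation "placeArr" => 11
local notation "numVar" => 12
local notation "guessVar" => 13
local notation "forbidVar" => 14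
local notation "enviedVar" => 15
local notation "costArr" => 16
local notation "asgArr" => 17
local notation "priceArr" => 18
local notation "idleVar" => 19
local notation "bidVar" => 20
local notation "totVar" => 21
local notation "agentsE" => Expr.get 0 0
local notation "housesE" => Expr.get 0 1

/-- The memory contains the instance `G`, `P`. -/
structure IsInput {n m : ℕ} (G : SimpleGraph (Fin n)) (P : Fin n → Finset (Fin m)) (s : Mem) :
    Prop where
  agents : s dimArr 0 = n
  houses : s dimArr 1 = m
  adj : ∀ a b : Fin n, G.Adj a b → s adjArr (a * n + b) = 1
  not_adj : ∀ a b : Fin n, ¬G.Adj a b → s adjArr (a * n + b) = 0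
  pref : ∀ (a : Fin n) (h : Fin m), h ∈ P a → s prefArr (a * m + h) = 1
  not_pref : ∀ (a : Fin n) (h : Fin m), h ∉ P a → s prefArr (a * m + h) = 0

theorem mul_add_inj {n : ℕ} {a a' : ℕ} {b b' : Fin n} (h : a * n + b = a' * n + b') :
    a = a' ∧ b = b' := by
  have h1 : (a * n + b) / n = a := by
    rw [add_comm, Nat.add_mul_div_right _ _ b.pos, Nat.div_eq_of_lt b.2, zero_add]
  have h2 : (a' * n + b') / n = a' := by
    rw [add_comm, Nat.add_mul_div_right _ _ b.pos, Nat.div_eq_of_lt b'.2, zero_add]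
  have h3 : a = a' := by rw [← h1, h, h2]
  subst h3
  exact ⟨rfl, Fin.ext (by omega)⟩

section Specs

variable {n m R M : ℕ} {G : SimpleGraph (Fin n)} {P : Fin n → Finset (Fin m)} {s s' : Mem}

theorem isInput_inputMem : IsInput G P (inputMem G P) where
  agents := by simp [inputMem]
  houses := by simp [inputMem]
  adj a b h := by
    simp only [inputMem, one_ne_zero, if_false, if_true]
    exact if_pos ⟨a, b, rfl, h⟩
  not_adj a b h := by
    simp only [inputMem, one_ne_zero, if_false, if_true]
    refine if_neg ?_
    rintro ⟨a', b', h1, h2⟩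
    obtain ⟨h3, rfl⟩ := mul_add_inj h1
    exact h (Fin.ext h3 ▸ h2)
  pref a x h := by
    simp only [inputMem, OfNat.ofNat_ne_zero, OfNat.ofNat_ne_one, if_false, if_true]
    exact if_pos ⟨a, x, rfl, h⟩
  not_pref a x h := by
    simp only [inputMem, OfNat.ofNat_ne_zero, OfNat.ofNat_ne_one, if_false, if_true]
    refine if_neg ?_
    rintro ⟨a', x', h1, h2⟩
    obtain ⟨h3, rfl⟩ := mul_add_inj h1
    exact h (Fin.ext h3 ▸ h2)

theorem IsInput.congr (h : IsInput G P s) (h0 : s' dimArr = s dimArr) (h1 : s' adjArr = s adjArr)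
    (h2 : s' prefArr = s prefArr) : IsInput G P s' := by
  constructor <;> simp only [h0, h1, h2]
  exacts [h.agents, h.houses, h.adj, h.not_adj, h.pref, h.not_pref]

/-- The bounds that the memory and the loops of the program need. -/
structure Capacity (n m R M : ℕ) : Prop where
  le : n ≤ m
  iter_le : R ≤ M
  houses_le : 2 * m + 2 ≤ R
  adj_le : n * n ≤ R
  pref_le : n * m ≤ R
  rounds_le : m * ((n + 1) * (n + 1) * (n + 1) + 1) + 1 ≤ R
  cost_le : (n + 1) * (n + 1) * (n + 1) + 2 ≤ R
  -- Codes and place values can be this large. They only have to fit into the memory, so `M` is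
  -- bounded from below here and `R` is not.
  pow_le : (2 * m) ^ n ≤ M

/-! #### The vertex cover -/

/-- Unpacks the set of agents with the code in `codeVar`. -/
def decodeCover : Cmd :=
  .seq (forLoop iVar (2 * housesE) (.write covArr (.get iVar 0) 0))
  (.seq (.write remVar 0 (.get codeVar 0))
    (forLoop iVar agentsE
      (.seq (.write covArr (Expr.get remVar 0 % (2 * housesE)) 1)
        (.write remVar 0 (Expr.get remVar 0 / (2 * housesE))))))

open scoped Classical in
-- The array is indexed by digit values: the cell `0` absorbs the zero digits, and the agent `a`
-- owns the cell `a + 1`.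
theorem wp_decodeCover (hc : Capacity n m R M) (hs : IsInput G P s) :
    wp M R decodeCover (fun s' => ∀ i < 2 * m,
      s' covArr i = if CodeMem n (2 * m) (s codeVar 0) i then 1 else 0) s := by
  have h1 := hc.iter_le
  have h2 := hc.houses_le
  have h3 := hc.le
  refine wp_seq (wp_mono (Q := fun s' => ∀ i < 2 * m, s' covArr i = 0) ?_ ?_)
  · refine wp_forLoop (N := 2 * m) (fun j s' => ∀ i < j, s' covArr i = 0) (by omega) (by omega) rfl
      ?_ (by simp) ?_ (fun _ _ h => h) ?_
    · intro s' hf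
      simp [hf dimArr rfl, hs.houses]
    · intro j hj s' hf hij hI
      refine wp_write (fun _ => by simp) ?_
      intro i hi
      simp only [Mem.write_apply, Expr.eval_get, Expr.eval_zero, hij, true_and]
      split_ifs with h
      · rfl
      · exact hI i (by omega)
    · intro j s' v h
      simpa using h
  intro s₁ hf₁ _ hz
  have hs₁ : IsInput G P s₁ := hs.congr (hf₁ dimArr rfl) (hf₁ adjArr rfl) (hf₁ prefArr rfl)
  refine wp_bounded fun hb => wp_seq (wp_write (fun _ => ?_) ?_)
  · simpa using hb codeVar 0
  have hcode : s₁ codeVar = s codeVar := hf₁ codeVar rfl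
  refine wp_forLoop (N := n) (fun j s' => s' remVar 0 = s codeVar 0 / (2 * m) ^ j ∧
    ∀ i < 2 * m, s' covArr i = if CodeMem j (2 * m) (s codeVar 0) i then 1 else 0)
    (by omega) (by omega) rfl ?_ ?_ ?_ (fun _ _ h => h.2) ?_
  · intro s' hf
    simp [hf dimArr rfl, hs₁.agents]
  · refine ⟨by simp [hcode], fun i hi => ?_⟩
    simp [hz i hi, CodeMem]
  · rintro j hj s' hf hij ⟨hr, hI⟩
    have hm : s' dimArr 1 = m := by rw [hf dimArr rfl]; simp [hs₁.houses]
    refine wp_seq (wp_write (fun _ => by simp; omega) ?_)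
    refine wp_write (fun hb' => ?_) ?_
    · refine (Nat.div_le_self _ _).trans ?_
      exact hb' remVar 0
    · simp only [Mem.write_apply, Expr.eval_get, Expr.eval_zero, Expr.eval_mod, Expr.eval_div,
        Expr.eval_mul, Expr.eval_two, Expr.eval_one, hm, hr]
      refine ⟨by simp [pow_succ, Nat.div_div_eq_div_mul], fun i hi => ?_⟩
      have hiff : CodeMem (j + 1) (2 * m) (s codeVar 0) i ↔
          i = s codeVar 0 / (2 * m) ^ j % (2 * m) ∨ CodeMem j (2 * m) (s codeVar 0) i := by
        constructor
        · rintro ⟨l, hl, hli⟩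
          rcases Nat.lt_succ_iff_lt_or_eq.1 hl with hl | rfl
          · exact .inr ⟨l, hl, hli⟩
          · exact .inl hli.symm
        · rintro (h | ⟨l, hl, hli⟩)
          · exact ⟨j, by omega, h.symm⟩
          · exact ⟨l, by omega, hli⟩
      simp only [hiff, hI i hi]
      by_cases h : i = s codeVar 0 / (2 * m) ^ j % (2 * m) <;> simp [h]
  · intro j s' v h
    simpa using h

open scoped Classical in
/-- The set of agents with the code `g`. -/
noncomputable def codeSet (n m g : ℕ) : Finset (Fin n) :=
  Finset.univ.filter fun a => CodeMem n (2 * m) g (a + 1)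

/-- The memory contains the set `T`. -/
structure HoldsCover (T : Finset (Fin n)) (s : Mem) : Prop where
  mem : ∀ a ∈ T, s covArr (a + 1) = 1
  not_mem : ∀ a ∉ T, s covArr (a + 1) = 0

theorem HoldsCover.congr {T : Finset (Fin n)} (h : HoldsCover T s) (h' : s' covArr = s covArr) :
    HoldsCover T s' :=
  ⟨fun a ha => by rw [h']; exact h.mem a ha, fun a ha => by rw [h']; exact h.not_mem a ha⟩

/-- Counts the pairs of adjacent agents that are not covered. -/
def countUncovered : Cmd :=
  sumLoop iVar badVar (agentsE * agentsE)
    (Expr.get adjArr (.get iVar 0) * ((1 - Expr.get covArr (Expr.get iVar 0 / agentsE + 1)) *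
      (1 - Expr.get covArr (Expr.get iVar 0 % agentsE + 1))))

theorem wp_countUncovered (hc : Capacity n m R M) (hs : IsInput G P s) {T : Finset (Fin n)}
    (hT : HoldsCover T s) :
    wp M R countUncovered (fun s' => s' badVar 0 = 0 ↔ G.IsVertexCover (T : Set (Fin n))) s := by
  classical
  have h1 := hc.iter_le
  have h2 := hc.adj_le
  have hdiv : ∀ j : Fin (n * n), (j : ℕ) / n < n := fun j => Nat.div_lt_of_lt_mul j.2
  have hpos : ∀ j : Fin (n * n), 0 < n := fun j => (hdiv j).pos
  refine wp_sumLoop_fin (N := n * n) (F := fun j =>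
    if G.Adj ⟨j / n, hdiv j⟩ ⟨j % n, Nat.mod_lt _ (hpos j)⟩ ∧ (⟨j / n, hdiv j⟩ : Fin n) ∉ T ∧
      (⟨j % n, Nat.mod_lt _ (hpos j)⟩ : Fin n) ∉ T then 1 else 0) (by omega) (by omega)
    (by decide) ?_ ?_ ?_ ?_
  · intro s' hf
    simp [hf dimArr rfl, hs.agents]
  · intro j s' hf hj
    have hf0 : s' dimArr = s dimArr := hf dimArr rfl
    have hf1 : s' adjArr = s adjArr := hf adjArr rfl
    have hf2 : s' covArr = s covArr := hf covArr rfl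
    simp only [Expr.eval_mul, Expr.eval_sub, Expr.eval_get, Expr.eval_zero, Expr.eval_one,
      Expr.eval_add, Expr.eval_div, Expr.eval_mod, hj, hf0, hf1, hf2, hs.agents]
    have hja : (j : ℕ) = j / n * n + j % n := (Nat.div_add_mod' _ _).symm
    set a : Fin n := ⟨j / n, hdiv j⟩ with ha
    set b : Fin n := ⟨j % n, Nat.mod_lt _ (hpos j)⟩ with hb
    have hav : (j : ℕ) / n = a := rfl
    have hbv : (j : ℕ) % n = b := rfl
    rw [hav, hbv] at hja ⊢
    rw [hja]
    by_cases h3 : G.Adj a b <;> by_cases h4 : a ∈ T <;> by_cases h5 : b ∈ T <;>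
      simp [h3, h4, h5, hs.adj, hs.not_adj, hT.mem, hT.not_mem]
  · refine (Finset.sum_le_card_nsmul _ _ 1 fun j _ => by split_ifs <;> omega).trans ?_
    simp only [Finset.card_univ, Fintype.card_fin, smul_eq_mul, mul_one]
    omega
  · intro s' _ hsum
    rw [hsum, Finset.sum_eq_zero_iff]
    constructor
    · intro h a b hab
      by_contra! hcon
      have hlt : (a : ℕ) * n + b < n * n := by
        have := Nat.mul_le_mul_right n (Nat.succ_le_of_lt a.2)
        rw [Nat.succ_eq_add_one, add_mul, one_mul] at this
        have := b.2
        omega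
      have h3 := h ⟨a * n + b, hlt⟩ (Finset.mem_univ _)
      have h4 : ((a : ℕ) * n + b) / n = a := by
        rw [add_comm, Nat.add_mul_div_right _ _ b.pos, Nat.div_eq_of_lt b.2, zero_add]
      have h5 : ((a : ℕ) * n + b) % n = b := by
        rw [add_comm, Nat.add_mul_mod_self_right, Nat.mod_eq_of_lt b.2]
      simp only [h4, h5, Fin.eta, Finset.mem_coe] at h3 hcon
      simp [hab, hcon.1, hcon.2] at h3
    · intro h j _
      refine if_neg ?_
      rintro ⟨h3, h4, h5⟩
      rcases h h3 with h6 | h6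
      · exact h4 h6
      · exact h5 h6

/-- Checks whether the set with the code in `codeVar` is a vertex cover. -/
def tryCover : Cmd := .seq decodeCover countUncovered

theorem wp_tryCover (hc : Capacity n m R M) (hs : IsInput G P s) :
    wp M R tryCover (fun s' => HoldsCover (codeSet n m (s codeVar 0)) s' ∧
      (s' badVar 0 = 0 ↔ G.IsVertexCover (codeSet n m (s codeVar 0) : Set (Fin n)))) s := by
  have h3 := hc.le
  refine wp_seq (wp_mono (wp_decodeCover hc hs) fun s₁ hf₁ _ h₁ => ?_)
  have hs₁ : IsInput G P s₁ := hs.congr (hf₁ dimArr rfl) (hf₁ adjArr rfl) (hf₁ prefArr rfl)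
  have hT : HoldsCover (codeSet n m (s codeVar 0)) s₁ := by
    constructor <;> intro a ha <;> rw [h₁ _ (by omega)] <;> simpa [codeSet] using ha
  refine wp_mono (wp_countUncovered hc hs₁ hT) fun s₂ hf₂ _ h₂ => ⟨hT.congr (hf₂ covArr rfl), h₂⟩

/-! #### The guesses for the vertex cover -/

/-- The place value of the digit of the agent `a` in the code of a guess. -/
noncomputable def placeValue (m : ℕ) (T : Finset (Fin n)) (a : ℕ) : ℕ :=
  ∏ i ∈ Finset.range a, if i ∈ T.image (fun a : Fin n => (a : ℕ)) then 2 * m else 1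

theorem placeValue_eq_pow (m : ℕ) (T : Finset (Fin n)) : placeValue m T n = (2 * m) ^ T.card := by
  have h1 : Finset.filter (fun i => i ∈ T.image (fun a : Fin n => (a : ℕ))) (Finset.range n)
      = T.image (fun a : Fin n => (a : ℕ)) := by
    ext i
    simp only [Finset.mem_filter, Finset.mem_range, Finset.mem_image, and_iff_right_iff_imp]
    rintro ⟨a, -, rfl⟩
    exact a.2
  rw [placeValue, Finset.prod_ite, Finset.prod_const, Finset.prod_const_one, mul_one, h1,
    Finset.card_image_of_injective _ Fin.val_injective]

/-- Computes the place values of the digits, and the number of guesses. -/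
def placeValues : Cmd :=
  .seq (.write numVar 0 1)
    (forLoop iVar agentsE (.seq (.write placeArr (.get iVar 0) (.get numVar 0))
      (.write numVar 0 (Expr.get numVar 0 *
        (1 + Expr.get covArr (Expr.get iVar 0 + 1) * (2 * housesE - 1))))))

theorem wp_placeValues (hc : Capacity n m R M) (hs : IsInput G P s) {T : Finset (Fin n)}
    (hT : HoldsCover T s) :
    wp M R placeValues (fun s' => (∀ a : Fin n, s' placeArr a = placeValue m T a) ∧
      s' numVar 0 = (2 * m) ^ T.card) s := by
  have h1 := hc.iter_le
  have h2 := hc.houses_le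
  have h3 := hc.le
  have hsucc : ∀ a : Fin n, placeValue m T (a + 1) = placeValue m T a *
      if a ∈ T then 2 * m else 1 := by
    intro a
    rw [placeValue, Finset.prod_range_succ, ← placeValue]
    congr 1
    simp [Fin.val_inj]
  have hle : ∀ a ≤ n, placeValue m T a ≤ M := by
    intro a ha
    -- For `a > 0` also `n`, and hence `m`, is positive, so powers of `2 * m` are monotone in the
    -- exponent.
    rcases Nat.eq_zero_or_pos a with rfl | hpos
    · simp only [placeValue, Finset.range_zero, Finset.prod_empty]
      omega
    refine le_trans ?_ hc.pow_le
    have h4 : placeValue m T a ≤ (2 * m) ^ a := by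
      refine (Finset.prod_le_pow_card _ _ (2 * m) fun i _ => ?_).trans (by simp)
      split_ifs <;> omega
    exact h4.trans (Nat.pow_le_pow_right (by omega) ha)
  refine wp_seq (wp_write (fun _ => by simp; omega) ?_)
  refine wp_forLoop (N := n) (fun j s' => (∀ a : Fin n, a < j → s' placeArr a = placeValue m T a) ∧
      s' numVar 0 = placeValue m T j) (by omega) (by omega) rfl ?_ ?_ ?_ ?_ ?_
  · intro s' hf
    simp [hf dimArr rfl, hs.agents]
  · simp [placeValue]
  · rintro j hj s' hf hij ⟨hI, hnum⟩
    have hm : s' dimArr 1 = m := by rw [hf dimArr rfl]; simp [hs.houses]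
    have hval : placeValue m T j * (1 + s' covArr (j + 1) * (2 * m - 1))
        = placeValue m T (j + 1) := by
      have hcov : s' covArr (j + 1) = s covArr (j + 1) := by rw [hf covArr rfl]; simp
      have := hsucc ⟨j, hj⟩
      simp only at this
      rw [this, hcov]
      congr 1
      split_ifs with h
      · have := hT.mem _ h
        simp only at this
        rw [this]
        omega
      · have := hT.not_mem _ h
        simp only at this
        rw [this]
        omega
    refine wp_seq (wp_write (fun _ => ?_) (wp_write (fun _ => ?_) ?_))
    · simp only [Expr.eval_get, Expr.eval_zero, hnum]
      exact hle j hj.le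
    · simp [hnum, hij, hm, hval]
      exact hle _ hj
    · simp only [Mem.write_apply, Expr.eval_get, Expr.eval_zero, Expr.eval_add, Expr.eval_sub,
        Expr.eval_mul, Expr.eval_two, Expr.eval_one, hm, hnum, hij]
      refine ⟨fun a ha => ?_, by simpa using hval⟩
      simp only [Nat.reduceEqDiff, false_and, if_false, true_and]
      split_ifs with h
      · rw [h]
      · exact hI a (by omega)
  · rintro s' - ⟨hI, hnum⟩
    exact ⟨fun a => hI a a.2, by rw [hnum, placeValue_eq_pow]⟩
  · intro j s' v h
    simpa using h

/-! #### The costs for a guess -/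

/-- The memory contains a guess: the houses `x` for the agents in the vertex cover and the set `e`
of those among them that may become envious. -/
structure HoldsGuess (T : Finset (Fin n)) (x : Fin n → Fin m) (e : Fin n → Prop) (s : Mem) :
    Prop where
  house : ∀ a ∈ T, s guessVar 0 / s placeArr a % (2 * m) / 2 = x a
  flag : ∀ a ∈ T, e a → s guessVar 0 / s placeArr a % (2 * m) % 2 = 1
  not_flag : ∀ a ∈ T, ¬e a → s guessVar 0 / s placeArr a % (2 * m) % 2 = 0

theorem HoldsGuess.congr {T : Finset (Fin n)} {x : Fin n → Fin m} {e : Fin n → Prop}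
    (h : HoldsGuess T x e s) (h1 : s' guessVar = s guessVar) (h2 : s' placeArr = s placeArr) :
    HoldsGuess T x e s' := by
  constructor <;> simp only [h1, h2]
  exacts [h.house, h.flag, h.not_flag]

/-- The digit of the agent `a` in the code of the guess. -/
def digitE (a : Expr) : Expr := Expr.get guessVar 0 / Expr.get placeArr a % (2 * housesE)

@[simp] theorem eval_digitE (a : Expr) (s : Mem) : (digitE a).eval s =
    s guessVar 0 / s placeArr (a.eval s) % (2 * s dimArr 1) := rfl

/-- The agent of the entry of the cost matrix under consideration. -/
def rowE : Expr := Expr.get iVar 0 / housesE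

/-- The house of the entry of the cost matrix under consideration. -/
def colE : Expr := Expr.get iVar 0 % housesE

@[simp] theorem eval_rowE (s : Mem) : rowE.eval s = s iVar 0 / s dimArr 1 := rfl

@[simp] theorem eval_colE (s : Mem) : colE.eval s = s iVar 0 % s dimArr 1 := rfl

/-- Counts the agents in the vertex cover that must not become envious, but would if the agent
`rowE` received the house `colE`. -/
def countForbidding : Cmd :=
  sumLoop jVar forbidVar agentsE
    (Expr.get covArr (Expr.get jVar 0 + 1) * (Expr.get adjArr (rowE * agentsE + Expr.get jVar 0) *
      ((1 - digitE (.get jVar 0) % 2) *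
        ((1 - Expr.get prefArr (Expr.get jVar 0 * housesE + digitE (.get jVar 0) / 2)) *
          Expr.get prefArr (Expr.get jVar 0 * housesE + colE)))))

/-- Counts the agents in the vertex cover that receive a house preferred by their neighbour
`rowE`. -/
def countEnvied : Cmd :=
  sumLoop jVar enviedVar agentsE
    (Expr.get covArr (Expr.get jVar 0 + 1) * (Expr.get adjArr (rowE * agentsE + Expr.get jVar 0) *
      Expr.get prefArr (rowE * housesE + digitE (.get jVar 0) / 2)))

/-- The entry of the cost matrix. -/
def costE : Expr :=
  (agentsE + 1) *
    (Expr.get covArr (rowE + 1) *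
        ((1 - Expr.op .eq (digitE rowE / 2) colE) * (agentsE + 1)) +
      (1 - Expr.get covArr (rowE + 1)) *
        ((agentsE + 1) * Expr.get forbidVar 0 +
          Expr.op .lt 0 (.get enviedVar 0) * (1 - Expr.get prefArr (.get iVar 0))))

/-- Computes the cost matrix for the guess. -/
def costs : Cmd :=
  forLoop iVar (agentsE * housesE)
    (.seq countForbidding (.seq countEnvied (.write costArr (.get iVar 0) costE)))

section Costs

variable {T : Finset (Fin n)} {x : Fin n → Fin m} {e : Fin n → Prop}

theorem row_eq (a : ℕ) (h : Fin m) : (a * m + h) / m = a := by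
  rw [add_comm, Nat.add_mul_div_right _ _ h.pos, Nat.div_eq_of_lt h.2, zero_add]

theorem col_eq (a : ℕ) (h : Fin m) : (a * m + h) % m = h := by
  rw [add_comm, Nat.add_mul_mod_self_right, Nat.mod_eq_of_lt h.2]

theorem entry_lt (a : Fin n) (h : Fin m) : (a : ℕ) * m + h < n * m := by
  have := Nat.mul_le_mul_right m (Nat.succ_le_of_lt a.2)
  rw [Nat.succ_eq_add_one, add_mul, one_mul] at this
  have := h.2
  omega

open scoped Classical in
theorem wp_countForbidding (hc : Capacity n m R M) (hs : IsInput G P s) (hT : HoldsCover T s)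
    (hg : HoldsGuess T x e s) {a : Fin n} {h : Fin m} (hi : s iVar 0 = a * m + h) :
    wp M R countForbidding (fun s' => s' forbidVar 0 = (Finset.univ.filter fun b =>
      b ∈ T ∧ G.Adj a b ∧ ¬e b ∧ x b ∉ P b ∧ h ∈ P b).card) s := by
  have h1 := hc.iter_le
  have h2 := hc.houses_le
  have h3 := hc.le
  refine wp_sumLoop_fin (N := n) (F := fun b =>
    if b ∈ T ∧ G.Adj a b ∧ ¬e b ∧ x b ∉ P b ∧ h ∈ P b then 1 else 0) (by omega) (by omega)
    (by decide) ?_ ?_ ?_ ?_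
  · intro s' hf
    simp [hf dimArr rfl, hs.agents]
  · intro b s' hf hj
    have hf0 : s' dimArr = s dimArr := hf dimArr rfl
    have hf1 : s' adjArr = s adjArr := hf adjArr rfl
    have hf2 : s' prefArr = s prefArr := hf prefArr rfl
    have hf3 : s' covArr = s covArr := hf covArr rfl
    have hf4 : s' iVar = s iVar := hf iVar rfl
    have hf5 : s' guessVar = s guessVar := hf guessVar rfl
    have hf6 : s' placeArr = s placeArr := hf placeArr rfl
    simp only [Expr.eval_mul, Expr.eval_sub, Expr.eval_get, Expr.eval_zero, Expr.eval_one,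
      Expr.eval_two, Expr.eval_add, Expr.eval_div, Expr.eval_mod, eval_digitE, eval_rowE,
      eval_colE, hj, hf0, hf1, hf2, hf3, hf4, hf5, hf6, hs.agents, hs.houses, hi, row_eq, col_eq]
    by_cases hb : b ∈ T
    · by_cases k1 : G.Adj a b <;> by_cases k2 : e b <;> by_cases k3 : x b ∈ P b <;>
        by_cases k4 : h ∈ P b <;>
        simp [hb, hT.mem, hg.house, hg.flag, hg.not_flag, k1, k2, k3, k4, hs.adj, hs.not_adj,
          hs.pref, hs.not_pref]
    · simp [hb, hT.not_mem]
  · rw [← Finset.card_filter]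
    refine (Finset.card_le_univ _).trans ?_
    rw [Fintype.card_fin]
    omega
  · intro s' _ hsum
    rw [hsum, Finset.card_filter]

theorem wp_countEnvied (hc : Capacity n m R M) (hs : IsInput G P s) (hT : HoldsCover T s)
    (hg : HoldsGuess T x e s) {a : Fin n} {h : Fin m} (hi : s iVar 0 = a * m + h) :
    wp M R countEnvied (fun s' => 0 < s' enviedVar 0 ↔ ∃ b ∈ T, G.Adj a b ∧ x b ∈ P a) s := by
  classical
  have h1 := hc.iter_le
  have h2 := hc.houses_le
  have h3 := hc.le
  refine wp_sumLoop_fin (N := n) (F := fun b =>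
    if b ∈ T ∧ G.Adj a b ∧ x b ∈ P a then 1 else 0) (by omega) (by omega)
    (by decide) ?_ ?_ ?_ ?_
  · intro s' hf
    simp [hf dimArr rfl, hs.agents]
  · intro b s' hf hj
    have hf0 : s' dimArr = s dimArr := hf dimArr rfl
    have hf1 : s' adjArr = s adjArr := hf adjArr rfl
    have hf2 : s' prefArr = s prefArr := hf prefArr rfl
    have hf3 : s' covArr = s covArr := hf covArr rfl
    have hf4 : s' iVar = s iVar := hf iVar rfl
    have hf5 : s' guessVar = s guessVar := hf guessVar rfl
    have hf6 : s' placeArr = s placeArr := hf placeArr rfl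
    simp only [Expr.eval_mul, Expr.eval_get, Expr.eval_zero, Expr.eval_one,
      Expr.eval_two, Expr.eval_add, Expr.eval_div, eval_digitE, eval_rowE,
      hj, hf0, hf1, hf2, hf3, hf4, hf5, hf6, hs.agents, hs.houses, hi, row_eq]
    by_cases hb : b ∈ T
    · by_cases k1 : G.Adj a b <;> by_cases k2 : x b ∈ P a <;>
        simp [hb, hT.mem, hg.house, k1, k2, hs.adj, hs.not_adj, hs.pref, hs.not_pref]
    · simp [hb, hT.not_mem]
  · rw [← Finset.card_filter]
    refine (Finset.card_le_univ _).trans ?_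
    rw [Fintype.card_fin]
    omega
  · intro s' _ hsum
    rw [hsum, ← Finset.card_filter, Finset.card_pos]
    simp only [Finset.Nonempty, Finset.mem_filter, Finset.mem_univ, true_and]

/-- The factor `n + 1` makes different total costs differ by more than the error `n` of the auction.
-/
theorem wp_costs (hc : Capacity n m R M) (hs : IsInput G P s) (hT : HoldsCover T s)
    (hg : HoldsGuess T x e s) :
    wp M R costs (fun s' => ∀ (a : Fin n) (h : Fin m),
      s' costArr (a * m + h) = (n + 1) * guessCost G P T x e a h) s := by
  classical
  have h1 := hc.iter_le
  have h2 := hc.pref_le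
  have h3 := hc.cost_le
  refine wp_forLoop (N := n * m) (fun j s' => ∀ (a : Fin n) (h : Fin m), (a : ℕ) * m + h < j →
      s' costArr (a * m + h) = (n + 1) * guessCost G P T x e a h) (by omega) (by omega) rfl
      ?_ (by simp) ?_ (fun s' _ hI a h => hI a h (entry_lt a h)) ?_
  · intro s' hf
    simp [hf dimArr rfl, hs.agents, hs.houses]
  · intro j hj s' hf hij hI
    obtain ⟨a, h, hah⟩ : ∃ (a : Fin n) (h : Fin m), j = a * m + h := by
      have hm : 0 < m := Nat.pos_of_ne_zero (by rintro rfl; omega)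
      exact ⟨⟨j / m, (Nat.div_lt_iff_lt_mul hm).2 hj⟩, ⟨j % m, Nat.mod_lt _ hm⟩,
        (Nat.div_add_mod' _ _).symm⟩
    have hs' : IsInput G P s' := hs.congr (hf dimArr rfl) (hf adjArr rfl) (hf prefArr rfl)
    have hT' : HoldsCover T s' := hT.congr (hf covArr rfl)
    have hg' : HoldsGuess T x e s' := hg.congr (hf guessVar rfl) (hf placeArr rfl)
    refine wp_seq (wp_mono (wp_countForbidding hc hs' hT' hg' (hij.trans hah))
      fun s₁ hf₁ _ hF => ?_)
    have hs₁ : IsInput G P s₁ := hs'.congr (hf₁ dimArr rfl) (hf₁ adjArr rfl) (hf₁ prefArr rfl)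
    have hT₁ : HoldsCover T s₁ := hT'.congr (hf₁ covArr rfl)
    have hg₁ : HoldsGuess T x e s₁ := hg'.congr (hf₁ guessVar rfl) (hf₁ placeArr rfl)
    have hi₁ : s₁ iVar 0 = a * m + h := by rw [hf₁ iVar rfl, hij, hah]
    refine wp_seq (wp_mono (wp_countEnvied hc hs₁ hT₁ hg₁ hi₁) fun s₂ hf₂ _ hE => ?_)
    have hs₂ : IsInput G P s₂ := hs₁.congr (hf₂ dimArr rfl) (hf₂ adjArr rfl) (hf₂ prefArr rfl)
    have hT₂ : HoldsCover T s₂ := hT₁.congr (hf₂ covArr rfl)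
    have hg₂ : HoldsGuess T x e s₂ := hg₁.congr (hf₂ guessVar rfl) (hf₂ placeArr rfl)
    have hi₂ : s₂ iVar 0 = a * m + h := by rw [hf₂ iVar rfl, hi₁]
    have hF₂ : s₂ forbidVar 0 = _ := (congrFun (hf₂ forbidVar rfl) 0).trans hF
    have hcost : costE.eval s₂ = (n + 1) * guessCost G P T x e a h := by
      simp only [costE, Expr.eval_mul, Expr.eval_sub, Expr.eval_get, Expr.eval_zero,
        Expr.eval_one, Expr.eval_two, Expr.eval_add, Expr.eval_div, Expr.eval_eq, Expr.eval_lt,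
        eval_digitE, eval_rowE, eval_colE, hs₂.agents, hs₂.houses, hi₂, row_eq, col_eq, hF₂, hE]
      congr 1
      unfold guessCost
      rw [Fintype.card_fin]
      by_cases ha : a ∈ T
      · rw [hT₂.mem a ha, hg₂.house a ha, if_pos ha]
        by_cases hx : x a = h
        · simp [hx]
        · simp [hx, Fin.val_inj]
      · rw [hT₂.not_mem a ha, if_neg ha]
        by_cases k1 : ∃ b ∈ T, G.Adj a b ∧ x b ∈ P a <;> by_cases k2 : h ∈ P a
        all_goals simp only [k1, k2, if_true, if_false, not_true_eq_false, not_false_eq_true,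
          and_true, and_false, hs₂.pref a h, hs₂.not_pref a h]
        all_goals simp
        all_goals congr!
    refine wp_write (fun _ => ?_) ?_
    · rw [hcost]
      have h4 := Nat.mul_le_mul_left (n + 1) (guessCost_le (G := G) (P := P) (T := T) (x := x)
        (e := e) a h)
      rw [Fintype.card_fin, ← mul_assoc] at h4
      omega
    · intro a' h' hlt
      rw [Mem.write_apply]
      simp only [Expr.eval_get, Expr.eval_zero, hi₂, true_and, hcost]
      split_ifs with heq
      · obtain ⟨h5, rfl⟩ := mul_add_inj heq
        obtain rfl := Fin.ext h5
        rfl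
      · rw [hf₂ costArr rfl, hf₁ costArr rfl]
        exact hI a' h' (by omega)
  · intro j s' v h
    simpa using h

end Costs

/-! #### The auction -/

/-- Finds a bidder `a` who holds no house and stores `a + 1`, or `0` if there is none. -/
def findIdle : Cmd :=
  .seq (.write idleVar 0 0)
    (forLoop jVar agentsE
      (.ite (.get asgArr (.get jVar 0)) .skip (.write idleVar 0 (Expr.get jVar 0 + 1))))

theorem wp_findIdle (hc : Capacity n m R M) (hn : s dimArr 0 = n) :
    wp M R findIdle (fun s' => (s' idleVar 0 = 0 ∧ ∀ a < n, s asgArr a ≠ 0) ∨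
      ∃ a < n, s' idleVar 0 = a + 1 ∧ s asgArr a = 0) s := by
  have h1 := hc.iter_le
  have h2 := hc.houses_le
  have h3 := hc.le
  refine wp_seq (wp_write (fun _ => by simp) ?_)
  refine wp_forLoop (N := n) (fun j s' => (s' idleVar 0 = 0 ∧ ∀ a < j, s asgArr a ≠ 0) ∨
      ∃ a < n, s' idleVar 0 = a + 1 ∧ s asgArr a = 0) (by omega) (by omega) rfl
      ?_ (by simp) ?_ (fun _ _ h => h) ?_
  · intro s' hf
    rw [Expr.eval_get, hf dimArr rfl]
    simp [hn]
  · intro j hj s' hf hij hI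
    have hA : s' asgArr = s asgArr := hf asgArr rfl
    refine wp_ite (fun he => wp_skip ?_) fun he => wp_write (fun _ => ?_) ?_
    · simp only [Expr.eval_get, Expr.eval_zero, hij, hA] at he
      refine hI.imp_left fun hI => ⟨hI.1, fun a ha => ?_⟩
      rcases Nat.lt_succ_iff_lt_or_eq.1 ha with ha | rfl
      · exact hI.2 a ha
      · exact he
    · simp only [Expr.eval_add, Expr.eval_get, Expr.eval_zero, Expr.eval_one, hij]
      omega
    · simp only [Expr.eval_get, Expr.eval_zero, hij, hA] at he
      exact .inr ⟨j, hj, by simp [hij], he⟩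
  · intro j s' v h
    simpa using h

/-- The cost of the house `h` for the bidder in `idleVar`, including its price. -/
def offerE (h : Expr) : Expr :=
  Expr.get costArr ((Expr.get idleVar 0 - 1) * housesE + h) + Expr.get priceArr h

/-- Finds the cheapest house for the bidder in `idleVar`. -/
def findBest : Cmd :=
  .seq (.write bidVar 0 0)
    (forLoop jVar housesE
      (.ite (.op .lt (offerE (.get jVar 0)) (offerE (.get bidVar 0)))
        (.write bidVar 0 (.get jVar 0)) .skip))

theorem wp_findBest (hc : Capacity n m R M) (hm : s dimArr 1 = m) (hpos : 0 < m) {a : ℕ}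
    (ha : s idleVar 0 = a + 1) :
    wp M R findBest (fun s' => s' bidVar 0 < m ∧ ∀ h < m,
      s costArr (a * m + s' bidVar 0) + s priceArr (s' bidVar 0) ≤
        s costArr (a * m + h) + s priceArr h) s := by
  have h1 := hc.iter_le
  have h2 := hc.houses_le
  refine wp_seq (wp_write (fun _ => by simp) ?_)
  refine wp_forLoop (N := m) (fun j s' => s' bidVar 0 < m ∧ ∀ h < j,
      s costArr (a * m + s' bidVar 0) + s priceArr (s' bidVar 0) ≤
        s costArr (a * m + h) + s priceArr h) (by omega) (by omega) rfl
      ?_ (by simpa using hpos) ?_ (fun _ _ h => h) ?_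
  · intro s' hf
    rw [Expr.eval_get, hf dimArr rfl]
    simp [hm]
  · rintro j hj s' hf hij ⟨hI, hI'⟩
    have hf0 : s' dimArr = s dimArr := hf dimArr rfl
    have hf1 : s' costArr = s costArr := hf costArr rfl
    have hf2 : s' priceArr = s priceArr := hf priceArr rfl
    have hf3 : s' idleVar = s idleVar := hf idleVar rfl
    have hcond : (Expr.op .lt (offerE (.get jVar 0)) (offerE (.get bidVar 0))).eval s' =
        if s costArr (a * m + j) + s priceArr j <
          s costArr (a * m + s' bidVar 0) + s priceArr (s' bidVar 0) then 1 else 0 := by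
      simp [offerE, hij, hf0, hf1, hf2, hf3, ha, hm]
    refine wp_ite (fun he => wp_write (fun _ => ?_) ?_) fun he => wp_skip ?_
    · simp only [Expr.eval_get, Expr.eval_zero, hij]
      omega
    · rw [hcond] at he
      simp only [ne_eq, ite_eq_right_iff, one_ne_zero, imp_false, not_not] at he
      simp only [Mem.write_apply, Expr.eval_get, Expr.eval_zero, hij, and_self, if_true]
      refine ⟨hj, fun h hh => ?_⟩
      rcases Nat.lt_succ_iff_lt_or_eq.1 hh with hh | rfl
      · exact he.le.trans (hI' h hh)
      · exact le_rfl
    · rw [hcond] at he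
      simp only [ite_eq_right_iff, one_ne_zero, imp_false, not_lt] at he
      refine ⟨hI, fun h hh => ?_⟩
      rcases Nat.lt_succ_iff_lt_or_eq.1 hh with hh | rfl
      · exact hI' h hh
      · exact he
  · intro j s' v h
    simpa using h

/-- Takes the house in `bidVar` from its holder. -/
def evict : Cmd :=
  forLoop jVar agentsE
    (.ite (.op .eq (.get asgArr (.get jVar 0)) (Expr.get bidVar 0 + 1))
      (.write asgArr (.get jVar 0) 0) .skip)

theorem wp_evict (hc : Capacity n m R M) (hn : s dimArr 0 = n) :
    wp M R evict (fun s' => ∀ a < n, s' asgArr a =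
      if s asgArr a = s bidVar 0 + 1 then 0 else s asgArr a) s := by
  have h1 := hc.iter_le
  have h2 := hc.houses_le
  have h3 := hc.le
  -- The invariant describes all cells, including those not yet visited, so the cell `j` is known to
  -- be untouched when it is tested.
  refine wp_forLoop (N := n) (fun j s' => ∀ a, s' asgArr a =
      if a < j ∧ s asgArr a = s bidVar 0 + 1 then 0 else s asgArr a) (by omega) (by omega) rfl
      ?_ (by simp) ?_ ?_ ?_
  · intro s' hf
    rw [Expr.eval_get, hf dimArr rfl]
    simp [hn]
  · intro j hj s' hf hij hI
    have hb : s' bidVar = s bidVar := hf bidVar rfl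
    have hj0 : s' asgArr j = s asgArr j := by simp [hI j]
    refine wp_ite (fun he => wp_write (fun _ => by simp) fun a => ?_) fun he => wp_skip fun a => ?_
    · have he' : s asgArr j = s bidVar 0 + 1 := by simpa [hij, hb, hj0] using he
      simp only [Mem.write_apply, Expr.eval_get, Expr.eval_zero, hij, true_and, hI a]
      by_cases haj : a = j
      · simp [haj, he']
      · have : a < j + 1 ↔ a < j := by omega
        simp [haj, this]
    · have he' : s asgArr j ≠ s bidVar 0 + 1 := by simpa [hij, hb, hj0] using he
      rw [hI a]
      by_cases haj : a = j
      · simp [haj, he']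
      · have : a < j + 1 ↔ a < j := by omega
        simp [this]
  · intro s' _ h a ha
    rw [h a]
    simp [ha]
  · intro j s' v h
    simpa using h

/-- The bid of the bidder in `idleVar`. -/
def bid : Cmd :=
  .seq findBest (.seq evict
    (.seq (.write asgArr (Expr.get idleVar 0 - 1) (Expr.get bidVar 0 + 1))
      (.write priceArr (.get bidVar 0) (Expr.get priceArr (.get bidVar 0) + 1))))

/-- The sum of the prices serves as the clock of the auction: it advances by exactly one with each
bid. -/
theorem wp_bid (hc : Capacity n m R M) (hn : s dimArr 0 = n) (hm : s dimArr 1 = m)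
    {c : ℕ → ℕ → ℕ} {B : ℕ} (hcost : ∀ a h, s costArr (a * m + h) = c a h)
    (hB : ∀ a < n, ∀ h < m, c a h ≤ B) (hBM : B + 2 ≤ M)
    (hI : AuctionInv n m B c (s asgArr) (s priceArr)) {a : ℕ} (han : a < n)
    (ha : s idleVar 0 = a + 1) (ha0 : s asgArr a = 0) :
    wp M R bid (fun s' => AuctionInv n m B c (s' asgArr) (s' priceArr) ∧
      ∑ h ∈ Finset.range m, s' priceArr h = ∑ h ∈ Finset.range m, s priceArr h + 1) s := by
  have h1 := hc.iter_le
  have h2 := hc.houses_le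
  have h3 := hc.le
  refine wp_seq (wp_mono (wp_findBest hc hm (by omega) ha) fun s₁ hf₁ _ h₁ => ?_)
  have hn₁ : s₁ dimArr 0 = n := by rw [hf₁ dimArr rfl, hn]
  refine wp_seq (wp_mono (wp_evict hc hn₁) fun s₂ hf₂ _ h₂ => ?_)
  have hi₂ : s₂ idleVar 0 = a + 1 := by rw [hf₂ idleVar rfl, hf₁ idleVar rfl, ha]
  have hb₂ : s₂ bidVar = s₁ bidVar := hf₂ bidVar rfl
  have hp₂ : s₂ priceArr = s priceArr := (hf₂ priceArr rfl).trans (hf₁ priceArr rfl)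
  have hA₁ : s₁ asgArr = s asgArr := hf₁ asgArr rfl
  obtain ⟨hbm, hmin⟩ := h₁
  simp only [hcost] at hmin
  rw [hA₁] at h₂
  have hbid := hI.bid h3 hB han ha0 hbm hmin
  refine wp_seq (wp_write (fun _ => ?_) (wp_write (fun _ => ?_) ?_))
  · simp only [Expr.eval_add, Expr.eval_get, Expr.eval_zero, Expr.eval_one, hb₂]
    omega
  · have := hI.price_le _ hbm
    simp [hb₂, hp₂]
    omega
  · have hprice : ∀ h, ((s₂.write asgArr ((Expr.get idleVar 0 - 1).eval s₂)
        ((Expr.get bidVar 0 + 1).eval s₂)).write priceArr (s₁ bidVar 0)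
          (s priceArr (s₁ bidVar 0) + 1)) priceArr h =
        if h = s₁ bidVar 0 then s priceArr (s₁ bidVar 0) + 1 else s priceArr h := by
      intro h
      simp [hp₂]
    have heval : (Expr.get priceArr (.get bidVar 0) + 1).eval (s₂.write asgArr
        ((Expr.get idleVar 0 - 1).eval s₂) ((Expr.get bidVar 0 + 1).eval s₂)) =
        s priceArr (s₁ bidVar 0) + 1 := by simp [hb₂, hp₂]
    have heval' : (Expr.get bidVar 0).eval (s₂.write asgArr
        ((Expr.get idleVar 0 - 1).eval s₂) ((Expr.get bidVar 0 + 1).eval s₂)) =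
        s₁ bidVar 0 := by simp [hb₂]
    rw [heval, heval']
    refine ⟨hbid.congr (fun b hb => ?_) fun h _ => hprice h, ?_⟩
    · have := h₂ b hb
      simp [hi₂, hb₂, this]
    · rw [← sum_price_bid hbm]
      exact Finset.sum_congr rfl fun h _ => hprice h

/-- Assigns houses to all agents at minimum cost. -/
def auction : Cmd :=
  .seq (forLoop iVar housesE
    (.seq (.write asgArr (.get iVar 0) 0) (.write priceArr (.get iVar 0) 0)))
  (forLoop iVar
    (housesE * ((agentsE + 1) * (agentsE + 1) * (agentsE + 1) + 1) + 1)
    (.seq findIdle (.ite (.get idleVar 0) bid .skip)))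

theorem wp_auction (hc : Capacity n m R M) (hn : s dimArr 0 = n) (hm : s dimArr 1 = m)
    {c : ℕ → ℕ → ℕ} (hcost : ∀ a h, s costArr (a * m + h) = c a h)
    (hB : ∀ a < n, ∀ h < m, c a h ≤ (n + 1) * (n + 1) * (n + 1)) :
    wp M R auction (fun s' => ∃ φ : Fin n ↪ Fin m, (∀ a : Fin n, s' asgArr a = φ a + 1) ∧
      ∀ ψ : Fin n ↪ Fin m, ∑ a : Fin n, c a (φ a) ≤ ∑ a : Fin n, c a (ψ a) + n) s := by
  have h1 := hc.iter_le
  have h2 := hc.houses_le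
  have h3 := hc.le
  have h4 := hc.rounds_le
  have h5 := hc.cost_le
  refine wp_seq (wp_mono (Q := fun s' => ∀ h < m, s' asgArr h = 0 ∧ s' priceArr h = 0)
    (wp_forLoop (N := m) (fun j s' => ∀ h < j, s' asgArr h = 0 ∧ s' priceArr h = 0)
      (by omega) (by omega) rfl ?_ (by simp) ?_ (fun _ _ h => h) ?_) ?_)
  · intro s' hf
    simp [hf dimArr rfl, hm]
  · intro j hj s' hf hij hI
    refine wp_seq (wp_write (fun _ => by simp) (wp_write (fun _ => by simp) fun h hh => ?_))
    by_cases hhj : h = j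
    · simp [hij, hhj]
    · have := hI h (by omega)
      simp [hij, hhj, this.1, this.2]
  · intro j s' v h
    simpa using h
  intro s₁ hf₁ _ hz
  have hn₁ : s₁ dimArr 0 = n := by rw [hf₁ dimArr rfl, hn]
  have hm₁ : s₁ dimArr 1 = m := by rw [hf₁ dimArr rfl, hm]
  have hcost₁ : s₁ costArr = s costArr := hf₁ costArr rfl
  set B := (n + 1) * (n + 1) * (n + 1) with hBdef
  -- Either everybody holds a house, and the remaining rounds do nothing, or every round so far made
  -- a bid and the prices sum to `j`. The latter is impossible at the end, as the sum never exceeds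
  -- `m * (B + 1)`.
  refine wp_forLoop (N := m * (B + 1) + 1) (fun j s' =>
      AuctionInv n m B c (s' asgArr) (s' priceArr) ∧
      ((∀ a < n, s' asgArr a ≠ 0) ∨ ∑ h ∈ Finset.range m, s' priceArr h = j))
      (by omega) (by omega) rfl ?_ ?_ ?_ ?_ ?_
  · intro s' hf
    simp [hf dimArr rfl, hn₁, hm₁, hBdef]
  · refine ⟨AuctionInv.init.congr (fun a ha => (hz a (by omega)).1) fun h hh => (hz h hh).2,
      .inr ?_⟩
    exact Finset.sum_eq_zero fun h hh => (hz h (Finset.mem_range.1 hh)).2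
  · rintro j hj s' hf hij ⟨hI, hor⟩
    have hn' : s' dimArr 0 = n := by rw [hf dimArr rfl, hn₁]
    have hm' : s' dimArr 1 = m := by rw [hf dimArr rfl, hm₁]
    have hcost' : s' costArr = s costArr := (hf costArr rfl).trans hcost₁
    refine wp_seq (wp_mono (wp_findIdle hc hn') fun s₂ hf₂ _ h₂ => ?_)
    have hA₂ : s₂ asgArr = s' asgArr := hf₂ asgArr rfl
    have hp₂ : s₂ priceArr = s' priceArr := hf₂ priceArr rfl
    refine wp_ite (fun he => ?_) fun he => wp_skip ?_
    · rcases h₂ with ⟨h0, -⟩ | ⟨a, han, ha, ha0⟩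
      · exact absurd h0 he
      · refine wp_mono (wp_bid hc (by rw [hf₂ dimArr rfl, hn']) (by rw [hf₂ dimArr rfl, hm'])
          (fun a h => by rw [hf₂ costArr rfl, hcost', hcost]) hB (by omega)
          (by rw [hA₂, hp₂]; exact hI) han ha (by rw [hA₂, ha0])) fun s₃ _ _ h₃ => ⟨h₃.1, ?_⟩
        refine .inr ?_
        rw [h₃.2, hp₂]
        rcases hor with hor | hor
        · exact absurd ha0 (hor a han)
        · rw [hor]
    · rcases h₂ with ⟨-, hall⟩ | ⟨a, han, ha, ha0⟩
      · rw [hA₂, hp₂]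
        exact ⟨hI, .inl hall⟩
      · simp [ha] at he
  · rintro s' - ⟨hI, hor⟩
    refine hI.exists_assignment ?_
    rcases hor with hor | hor
    · exact hor
    · have := hI.sum_price_le
      omega
  · intro j s' v h
    have hA := Mem.write_of_ne s' (x := iVar) (y := asgArr) 0 v (by decide)
    have hp := Mem.write_of_ne s' (x := iVar) (y := priceArr) 0 v (by decide)
    rw [hA, hp]
    exact h

/-! #### The choice of the best allocation -/

/-- Computes the envy of the allocation found by the auction. -/
def countEnvy : Cmd :=
  .seq (.write totVar 0 0)
    (forLoop iVar agentsE
      (.seq (sumLoop jVar enviedVar agentsE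
        (Expr.get adjArr (Expr.get iVar 0 * agentsE + Expr.get jVar 0) *
          Expr.get prefArr (Expr.get iVar 0 * housesE +
            (Expr.get asgArr (.get jVar 0) - 1))))
        (.write totVar 0 (Expr.get totVar 0 +
          (1 - Expr.get prefArr (Expr.get iVar 0 * housesE +
            (Expr.get asgArr (.get iVar 0) - 1))) * Expr.op .lt 0 (.get enviedVar 0)))))

theorem wp_countEnvy (hc : Capacity n m R M) (hs : IsInput G P s) {φ : Fin n ↪ Fin m}
    (hφ : ∀ a : Fin n, s asgArr a = φ a + 1) :
    wp M R countEnvy (fun s' => s' totVar 0 = envy G P φ) s := by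
  classical
  have h1 := hc.iter_le
  have h2 := hc.houses_le
  have h3 := hc.le
  refine wp_seq (wp_write (fun _ => by simp) ?_)
  refine wp_forLoop (N := n) (fun j s' => s' totVar 0 =
    (Finset.univ.filter fun a : Fin n => a < j ∧ Envious G P φ a).card) (by omega) (by omega) rfl
      ?_ (by simp) ?_ ?_ ?_
  · intro s' hf
    rw [Expr.eval_get, hf dimArr rfl]
    simp [hs.agents]
  · intro j hj s' hf hij hI
    have hs' : IsInput G P s' := hs.congr (hf dimArr rfl) (hf adjArr rfl) (hf prefArr rfl)
    have hA' : s' asgArr = s asgArr := hf asgArr rfl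
    set a : Fin n := ⟨j, hj⟩ with ha
    have hja : j = a := rfl
    refine wp_seq (wp_sumLoop_fin (N := n) (F := fun b =>
      if G.Adj a b ∧ φ b ∈ P a then 1 else 0) (by omega) (by omega) (by decide) ?_ ?_ ?_ ?_)
    · intro s₁ hf₁
      rw [Expr.eval_get, hf₁ dimArr rfl]
      simp [hs'.agents]
    · intro b s₁ hf₁ hjb
      have hf1 : s₁ dimArr = s' dimArr := hf₁ dimArr rfl
      have hf2 : s₁ adjArr = s' adjArr := hf₁ adjArr rfl
      have hf3 : s₁ prefArr = s' prefArr := hf₁ prefArr rfl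
      have hf4 : s₁ asgArr = s asgArr := (hf₁ asgArr rfl).trans hA'
      have hf5 : s₁ iVar 0 = a := by rw [hf₁ iVar rfl, hij]
      by_cases k1 : G.Adj a b <;> by_cases k2 : φ b ∈ P a <;>
        simp [k1, k2, hjb, hf1, hf2, hf3, hf4, hf5, hs'.agents, hs'.houses, hφ, hs'.adj,
          hs'.not_adj, hs'.pref, hs'.not_pref]
    · rw [← Finset.card_filter]
      refine (Finset.card_le_univ _).trans ?_
      rw [Fintype.card_fin]
      omega
    · intro s₁ hf₁ hsum
      have hf1 : s₁ dimArr = s' dimArr := hf₁ dimArr rfl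
      have hf3 : s₁ prefArr = s' prefArr := hf₁ prefArr rfl
      have hf4 : s₁ asgArr = s asgArr := (hf₁ asgArr rfl).trans hA'
      have hf5 : s₁ iVar 0 = a := by rw [hf₁ iVar rfl, hij]
      have hf6 : s₁ totVar = s' totVar := hf₁ totVar rfl
      have hpos : 0 < s₁ enviedVar 0 ↔ ∃ b, G.Adj a b ∧ φ b ∈ P a := by
        rw [hsum, ← Finset.card_filter, Finset.card_pos]
        simp only [Finset.Nonempty, Finset.mem_filter, Finset.mem_univ, true_and]
      have hsucc : (Finset.univ.filter fun b : Fin n => b < j + 1 ∧ Envious G P φ b).card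
          = (Finset.univ.filter fun b : Fin n => b < j ∧ Envious G P φ b).card
            + if Envious G P φ a then 1 else 0 := by
        have hsplit : (Finset.univ.filter fun b : Fin n => b < j + 1 ∧ Envious G P φ b)
            = (Finset.univ.filter fun b : Fin n => b < j ∧ Envious G P φ b) ∪
              (if Envious G P φ a then {a} else ∅) := by
          ext b
          have hb : (b : ℕ) < j + 1 ↔ (b : ℕ) < j ∨ b = a := by
            rw [Nat.lt_succ_iff_lt_or_eq, hja, Fin.val_inj]
          split_ifs with k
          · simp only [Finset.mem_filter, Finset.mem_univ, true_and, Finset.mem_union,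
              Finset.mem_singleton, hb]
            constructor
            · rintro ⟨h | h, h'⟩
              · exact .inl ⟨h, h'⟩
              · exact .inr h
            · rintro (⟨h, h'⟩ | rfl)
              · exact ⟨.inl h, h'⟩
              · exact ⟨.inr rfl, k⟩
          · simp only [Finset.mem_filter, Finset.mem_univ, true_and, Finset.mem_union,
              Finset.notMem_empty, or_false, hb]
            constructor
            · rintro ⟨h | rfl, h'⟩
              · exact ⟨h, h'⟩
              · exact absurd h' k
            · rintro ⟨h, h'⟩
              exact ⟨.inl h, h'⟩
        rw [hsplit, Finset.card_union_of_disjoint]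
        · congr 1
          split_ifs <;> simp
        · split_ifs
          · rw [Finset.disjoint_singleton_right]
            simp [ha]
          · exact Finset.disjoint_empty_right _
      have hval : (Expr.get totVar 0 +
          (1 - Expr.get prefArr (Expr.get iVar 0 * housesE +
            (Expr.get asgArr (.get iVar 0) - 1))) * Expr.op .lt 0 (.get enviedVar 0)).eval s₁
          = (Finset.univ.filter fun b : Fin n => b < j + 1 ∧ Envious G P φ b).card := by
        rw [hsucc]
        simp only [Expr.eval_mul, Expr.eval_sub, Expr.eval_get, Expr.eval_zero, Expr.eval_one,
          Expr.eval_add, Expr.eval_lt, hf1, hf3, hf4, hf5, hf6, hI, hs'.houses, hφ,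
          Nat.add_sub_cancel, hpos, Envious]
        by_cases k1 : φ a ∈ P a <;> by_cases k2 : ∃ b, G.Adj a b ∧ φ b ∈ P a <;>
          simp only [k1, k2, hs'.pref, hs'.not_pref, if_true, if_false, not_true_eq_false,
            not_false_eq_true, and_true, and_false, mul_one, mul_zero, Nat.sub_self, Nat.sub_zero]
      refine wp_write (fun _ => ?_) ?_
      · rw [hval]
        refine (Finset.card_le_univ _).trans ?_
        rw [Fintype.card_fin]
        omega
      · rw [hval]
        simp
  · intro s' _ hI
    rw [hI, envy_eq_card]
    simp
  · intro j s' v h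
    simpa using h

/-- Stores the allocation found by the auction if it is better than the best one so far. -/
def record : Cmd :=
  .ite (.op .lt (.get totVar 0) (.get bestVar 0))
    (.seq (.write bestVar 0 (.get totVar 0))
      (forLoop iVar agentsE (.write outArr (.get iVar 0) (Expr.get asgArr (.get iVar 0) - 1))))
    .skip

/-- The memory contains an allocation and its envy, or no allocation yet. -/
def HoldsBest (G : SimpleGraph (Fin n)) (P : Fin n → Finset (Fin m)) (s : Mem) : Prop :=
  s bestVar 0 = n + 1 ∨
    ∃ φ : Fin n ↪ Fin m, (∀ a : Fin n, s outArr a = φ a) ∧ s bestVar 0 = envy G P φ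

theorem wp_record (hc : Capacity n m R M) (hn : s dimArr 0 = n) {φ : Fin n ↪ Fin m}
    (hφ : ∀ a : Fin n, s asgArr a = φ a + 1) (htot : s totVar 0 = envy G P φ)
    (hbest : HoldsBest G P s) :
    wp M R record (fun s' => HoldsBest G P s' ∧ s' bestVar 0 ≤ s bestVar 0 ∧
      s' bestVar 0 ≤ envy G P φ) s := by
  have h1 := hc.iter_le
  have h2 := hc.houses_le
  have h3 := hc.le
  refine wp_ite (fun he => ?_) fun he => wp_skip ?_
  · have he' : envy G P φ < s bestVar 0 := by simpa [htot] using he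
    refine wp_seq (wp_write (fun _ => ?_) ?_)
    · have := envy_le_card G P φ
      rw [Fintype.card_fin] at this
      simp only [Expr.eval_get, Expr.eval_zero, htot]
      omega
    refine wp_forLoop (N := n) (fun j s' => ∀ a : Fin n, a < j → s' outArr a = φ a)
      (by omega) (by omega) rfl ?_ (by simp) ?_ ?_ ?_
    · intro s' hf
      simp [hf dimArr rfl, hn]
    · intro j hj s' hf hij hI
      have hA : s' asgArr j = φ ⟨j, hj⟩ + 1 := by
        rw [hf asgArr rfl, Mem.write_of_ne _ _ _ (by decide), ← hφ]
      refine wp_write (fun _ => ?_) fun a ha => ?_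
      · have := (φ ⟨j, hj⟩).2
        simp only [Expr.eval_sub, Expr.eval_get, Expr.eval_zero, Expr.eval_one, hij, hA]
        omega
      · simp only [Mem.write_apply, Expr.eval_sub, Expr.eval_get, Expr.eval_zero, Expr.eval_one,
          hij, hA, true_and, Nat.add_sub_cancel]
        split_ifs with haj
        · simp [← haj]
        · exact hI a (by omega)
    · intro s' hf hI
      have hb : s' bestVar 0 = envy G P φ := by
        rw [hf bestVar rfl]
        simp [htot]
      exact ⟨.inr ⟨φ, fun a => hI a a.2, hb⟩, by omega, hb.le⟩
    · intro j s' v h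
      simpa using h
  · have he' : s bestVar 0 ≤ envy G P φ := by simpa [htot] using he
    exact ⟨hbest, le_rfl, he'⟩

/-- Finds the best allocation for a guess. -/
def evalGuess : Cmd := .seq costs (.seq auction (.seq countEnvy record))

/-- An inconsistent guess does no harm: the auction still returns an allocation, and its true envy
is recorded. Only guesses that agree with some `ψ` are needed for optimality. -/
theorem wp_evalGuess (hc : Capacity n m R M) (hs : IsInput G P s) {T : Finset (Fin n)}
    (hT : HoldsCover T s) (hG : G.IsVertexCover (T : Set (Fin n))) {x : Fin n → Fin m}
    {e : Fin n → Prop} (hg : HoldsGuess T x e s) (hbest : HoldsBest G P s) :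
    wp M R evalGuess (fun s' => HoldsBest G P s' ∧ s' bestVar 0 ≤ s bestVar 0 ∧
      ∀ ψ : Fin n ↪ Fin m, (∀ a ∈ T, x a = ψ a) → (∀ a ∈ T, e a ↔ Envious G P ψ a) →
        s' bestVar 0 ≤ envy G P ψ) s := by
  have h3 := hc.le
  refine wp_seq (wp_mono (wp_costs hc hs hT hg) fun s₁ hf₁ _ h₁ => ?_)
  have hs₁ : IsInput G P s₁ := hs.congr (hf₁ dimArr rfl) (hf₁ adjArr rfl) (hf₁ prefArr rfl)
  refine wp_seq (wp_mono (wp_auction hc hs₁.agents hs₁.houses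
    (c := fun a h => s₁ costArr (a * m + h)) (fun _ _ => rfl) ?_) fun s₂ hf₂ _ h₂ => ?_)
  · intro a ha h hh
    have h4 := Nat.mul_le_mul_left (n + 1) (guessCost_le (G := G) (P := P) (T := T) (x := x)
      (e := e) ⟨a, ha⟩ ⟨h, hh⟩)
    rw [Fintype.card_fin, ← mul_assoc] at h4
    exact (h₁ ⟨a, ha⟩ ⟨h, hh⟩).trans_le h4
  obtain ⟨φ, hφ, hopt⟩ := h₂
  have hs₂ : IsInput G P s₂ := hs₁.congr (hf₂ dimArr rfl) (hf₂ adjArr rfl) (hf₂ prefArr rfl)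
  refine wp_seq (wp_mono (wp_countEnvy hc hs₂ hφ) fun s₃ hf₃ _ h₃ => ?_)
  have hs₃ : IsInput G P s₃ := hs₂.congr (hf₃ dimArr rfl) (hf₃ adjArr rfl) (hf₃ prefArr rfl)
  have hb₃ : s₃ bestVar = s bestVar :=
    (hf₃ bestVar rfl).trans ((hf₂ bestVar rfl).trans (hf₁ bestVar rfl))
  have ho₃ : s₃ outArr = s outArr :=
    (hf₃ outArr rfl).trans ((hf₂ outArr rfl).trans (hf₁ outArr rfl))
  refine wp_mono (wp_record hc hs₃.agents (fun a => by rw [hf₃ asgArr rfl, hφ]) h₃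
    (by rw [HoldsBest, hb₃, ho₃]; exact hbest)) fun s₄ _ _ h₄ => ⟨h₄.1, hb₃ ▸ h₄.2.1, ?_⟩
  intro ψ hx he
  refine h₄.2.2.trans (envy_le_of_guessCost_le hG hx he ?_)
  have h5 := hopt ψ
  simp only [h₁, ← Finset.mul_sum] at h5
  -- If `φ` were more expensive than `ψ`, the scaled costs would differ by at least `n + 1`, beyond
  -- the error `n`.
  by_contra! hlt
  have h6 := Nat.mul_le_mul_left (n + 1) (Nat.succ_le_of_lt hlt)
  rw [Nat.succ_eq_add_one, mul_add, mul_one] at h6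
  omega

/-! #### The whole program -/

/-- Searches the code of a vertex cover. -/
def findCover : Cmd :=
  .seq tryCover (.loop (.get badVar 0)
    (.seq (.write codeVar 0 (Expr.get codeVar 0 + 1)) tryCover))

/-- The number `g` of iterations is not bounded by `R`, so it appears as an explicit factor; the
body is charged by its uniform bound. -/
theorem runs_findCover (hc : Capacity n m R M) (hs : IsInput G P s) (hcode : s codeVar 0 = 0)
    {g : ℕ} (hg : G.IsVertexCover (codeSet n m g : Set (Fin n)))
    (hmin : ∀ g' < g, ¬G.IsVertexCover (codeSet n m g' : Set (Fin n))) (hgM : g ≤ M) :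
    Runs M ((g + 1) * findCover.bound (M.size + 1) R) findCover
      (fun s' => HoldsCover (codeSet n m g) s') s := by
  refine Runs.mono (Runs.seq (Runs.mono (wp_tryCover hc hs) le_rfl fun s₁ hf₁ _ h₁ =>
    Runs.loop (T := Cmd.bound (M.size + 1) R
      (.seq (.write codeVar 0 (Expr.get codeVar 0 + 1)) tryCover))
      (fun j s' => s' codeVar 0 = j ∧ HoldsCover (codeSet n m j) s' ∧
      (s' badVar 0 = 0 ↔ G.IsVertexCover (codeSet n m j : Set (Fin n)))) g ?_ ?_
      fun s' _ h => ⟨h.2.2.2 hg, h.2.1⟩)) ?_ fun _ _ _ h => h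
  · rw [hcode] at h₁
    exact ⟨by rw [hf₁ codeVar rfl, hcode], h₁⟩
  · rintro j hj s' hf ⟨hj', hT, hbad⟩
    have hs' : IsInput G P s' := (hs.congr (hf₁ dimArr rfl) (hf₁ adjArr rfl)
      (hf₁ prefArr rfl)).congr (hf dimArr rfl) (hf adjArr rfl) (hf prefArr rfl)
    refine ⟨fun h => hmin j hj (hbad.1 h), ?_⟩
    refine wp_seq (R := R) (wp_write (fun _ => ?_) ?_)
    · simp only [Expr.eval_add, Expr.eval_get, Expr.eval_zero, Expr.eval_one, hj']
      omega
    set s₂ := s'.write codeVar ((0 : Expr).eval s') ((Expr.get codeVar 0 + 1).eval s') with hs₂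
    have hcode₂ : s₂ codeVar 0 = j + 1 := by simp [hs₂, hj']
    have hin₂ : IsInput G P s₂ := hs'.congr (Mem.write_of_ne _ _ _ (by decide))
      (Mem.write_of_ne _ _ _ (by decide)) (Mem.write_of_ne _ _ _ (by decide))
    refine wp_mono (wp_tryCover hc hin₂) fun s₃ hf₃ _ h₃ => ?_
    rw [hcode₂] at h₃
    exact ⟨by rw [hf₃ codeVar rfl, hcode₂], h₃⟩
  · simp only [findCover, Cmd.bound]
    rw [mul_add (g + 1) (tryCover.bound (M.size + 1) R)]
    refine Nat.add_le_add (Nat.le_mul_of_pos_left _ (by omega)) (Nat.mul_le_mul_left _ ?_)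
    exact Nat.le_mul_of_pos_left _ (by omega)

/-- Prepares the search for the best guess. -/
def initSearch : Cmd := .seq placeValues (.write bestVar 0 (agentsE + 1))

/-- Tries all guesses. -/
def search : Cmd := forLoop guessVar (.get numVar 0) evalGuess

/-- The guess with the code `g` agrees with the allocation `ψ`. -/
def Agrees (G : SimpleGraph (Fin n)) (P : Fin n → Finset (Fin m)) (T : Finset (Fin n)) (g : ℕ)
    (ψ : Fin n ↪ Fin m) : Prop :=
  ∀ a ∈ T, g / placeValue m T a % (2 * m) / 2 = ψ a ∧
    (g / placeValue m T a % (2 * m) % 2 = 1 ↔ Envious G P ψ a)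

/-- The digit of `a` is twice the house plus the envy flag, a number below `2 * m`. -/
theorem exists_agrees (hnm : n ≤ m) (T : Finset (Fin n)) (ψ : Fin n ↪ Fin m) :
    ∃ g < (2 * m) ^ T.card, Agrees G P T g ψ := by
  classical
  rcases Nat.eq_zero_or_pos m with rfl | hm
  · obtain rfl : n = 0 := by omega
    have hT : T = ∅ := Subsingleton.elim _ _
    exact ⟨0, by simp [hT], fun a => a.elim0⟩
  obtain ⟨g, hg, hd⟩ := exists_digits (b := 2 * m) (by omega)
    (fun i => i ∈ T.image (fun a : Fin n => (a : ℕ)))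
    (fun i => if h : i < n then 2 * (ψ ⟨i, h⟩ : ℕ) + (if Envious G P ψ ⟨i, h⟩ then 1 else 0) else 0)
    (fun i => by
      split_ifs with h1 h2
      · have := (ψ ⟨i, h1⟩).2
        omega
      · have := (ψ ⟨i, h1⟩).2
        omega
      · omega) n
  refine ⟨g, ?_, fun a ha => ?_⟩
  · rw [← placeValue_eq_pow, placeValue]
    convert hg
  · have h1 : g / placeValue m T a % (2 * m) =
        2 * (ψ a : ℕ) + if Envious G P ψ a then 1 else 0 := by
      have := hd a a.2 (Finset.mem_image_of_mem _ ha)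
      simp only [a.2, dif_pos, Fin.eta] at this
      rw [← this, placeValue]
    rw [h1]
    split_ifs with h
    · exact ⟨by omega, by simp only [h, iff_true]; omega⟩
    · exact ⟨by omega, by simp only [h, iff_false]; omega⟩

theorem runs_search (hc : Capacity n m R M) (hs : IsInput G P s) {T : Finset (Fin n)}
    (hT : HoldsCover T s) (hG : G.IsVertexCover (T : Set (Fin n)))
    (hplace : ∀ a : Fin n, s placeArr a = placeValue m T a)
    (hnum : s numVar 0 = (2 * m) ^ T.card) (hbest : s bestVar 0 = n + 1) :
    Runs M (((2 * m) ^ T.card + 2) * (27 * (M.size + 1) + evalGuess.bound (M.size + 1) R)) search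
      (IsSolutionMem G P) s := by
  refine Runs.bounded fun hb => ?_
  have hNM : (2 * m) ^ T.card ≤ M := hnum ▸ hb numVar 0
  have h3 := hc.le
  refine Runs.mono (Runs.forLoop (N := (2 * m) ^ T.card)
    (T := evalGuess.bound (M.size + 1) R) (fun j s' => HoldsBest G P s' ∧
    ∀ g < j, ∀ ψ : Fin n ↪ Fin m, Agrees G P T g ψ → s' bestVar 0 ≤ envy G P ψ)
    hNM rfl ?_ ⟨.inl hbest, by simp⟩ ?_ ?_ ?_) ?_ fun _ _ _ h => h
  · intro s' hf
    rw [Expr.eval_get, hf numVar rfl]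
    exact hnum
  · rintro j hj s' hf hgj ⟨hI, hI'⟩
    have hs' : IsInput G P s' := hs.congr (hf dimArr rfl) (hf adjArr rfl) (hf prefArr rfl)
    -- Every `j` is a legitimate guess: a digit below `2 * m` halves to a house.
    have hlt : ∀ a : Fin n, j / placeValue m T a % (2 * m) / 2 < m := fun a => by
      have := a.pos
      have := Nat.mod_lt (j / placeValue m T a) (show 0 < 2 * m by omega)
      omega
    have hg : HoldsGuess T (fun a => (⟨_, hlt a⟩ : Fin m))
        (fun a => j / placeValue m T a % (2 * m) % 2 = 1) s' := by
      constructor <;> intro a _ <;> rw [hgj, hf placeArr rfl, hplace]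
      · exact id
      · intro h
        omega
    refine wp_mono (wp_evalGuess hc hs' (hT.congr (hf covArr rfl)) hG hg hI)
      fun s₁ _ _ h₁ => ⟨h₁.1, fun g hgj' ψ hψ => ?_⟩
    rcases Nat.lt_succ_iff_lt_or_eq.1 hgj' with hlt' | rfl
    · exact h₁.2.1.trans (hI' g hlt' ψ hψ)
    · exact h₁.2.2 ψ (fun a ha => Fin.ext (hψ a ha).1) fun a ha => (hψ a ha).2
  · rintro s' - ⟨hI, hI'⟩
    have hopt : ∀ ψ : Fin n ↪ Fin m, s' bestVar 0 ≤ envy G P ψ := fun ψ => by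
      obtain ⟨g, hg, hψ⟩ := exists_agrees (G := G) (P := P) h3 T ψ
      exact hI' g hg ψ hψ
    -- The initial value `n + 1` cannot survive: as `n ≤ m` there is an allocation, and its envy is
    -- at most `n`.
    rcases hI with hI | ⟨φ, hφ, hI⟩
    · have h4 := hopt (Fin.castLEEmb h3)
      have h5 := envy_le_card G P (Fin.castLEEmb h3)
      rw [Fintype.card_fin] at h5
      omega
    · exact ⟨φ, fun ψ => hI ▸ hopt ψ, hφ, hI⟩
  · intro j s' v h
    have hb := Mem.write_of_ne s' (x := guessVar) (y := bestVar) 0 v (by decide)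
    have ho := Mem.write_of_ne s' (x := guessVar) (y := outArr) 0 v (by decide)
    rw [HoldsBest, hb, ho]
    exact h
  -- The constant of `Runs.forLoop` is `3 + 2 * 2 + 20 = 27`.
  · have hw : (Expr.get numVar 0).weight = 2 := rfl
    rw [hw]
    generalize M.size + 1 = W
    generalize (2 * m) ^ T.card = N
    generalize evalGuess.bound W R = E
    nlinarith [Nat.zero_le E]

/-- The algorithm: it finds a smallest vertex cover, guesses the houses of the agents in the cover
and which of them become envious, and completes each guess by a minimum cost assignment. -/
def solve : Cmd := .seq findCover (.seq initSearch search)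

theorem runs_solve (hc : Capacity n m R M) (hs : IsInput G P s) (hcode : s codeVar 0 = 0)
    {g : ℕ} (hg : G.IsVertexCover (codeSet n m g : Set (Fin n)))
    (hmin : ∀ g' < g, ¬G.IsVertexCover (codeSet n m g' : Set (Fin n))) (hgM : g ≤ M) :
    Runs M ((g + 1) * findCover.bound (M.size + 1) R + (initSearch.bound (M.size + 1) R +
      ((2 * m) ^ (codeSet n m g).card + 2) *
        (27 * (M.size + 1) + evalGuess.bound (M.size + 1) R))) solve (IsSolutionMem G P) s := by
  have h1 := hc.iter_le
  have h2 := hc.houses_le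
  have h3 := hc.le
  refine Runs.seq (Runs.mono (runs_findCover hc hs hcode hg hmin hgM) le_rfl
    fun s₁ hf₁ _ hT => ?_)
  have hs₁ : IsInput G P s₁ := hs.congr (hf₁ dimArr rfl) (hf₁ adjArr rfl) (hf₁ prefArr rfl)
  refine Runs.seq (wp_seq (wp_mono (wp_placeValues hc hs₁ hT) fun s₂ hf₂ _ h₂ => ?_))
  have hs₂ : IsInput G P s₂ := hs₁.congr (hf₂ dimArr rfl) (hf₂ adjArr rfl) (hf₂ prefArr rfl)
  refine wp_write (fun _ => ?_) ?_
  · simp only [Expr.eval_add, Expr.eval_get, Expr.eval_zero, Expr.eval_one, hs₂.agents]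
    omega
  have hne : ∀ y ≠ bestVar,
      s₂.write bestVar ((0 : Expr).eval s₂) ((agentsE + 1).eval s₂) y = s₂ y :=
    fun y hy => Mem.write_of_ne _ _ _ hy
  refine runs_search hc (hs₂.congr (hne _ (by decide)) (hne _ (by decide)) (hne _ (by decide)))
    (hT.congr ((hne _ (by decide)).trans (hf₂ covArr rfl))) hg ?_ ?_ ?_
  · rw [hne _ (by decide)]
    exact h₂.1
  · rw [hne _ (by decide)]
    exact h₂.2
  · simp [hs₂.agents]

end Specs

/-! ### The first cover and the final estimate -/

/-- The code of the first vertex cover found by the algorithm. -/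
theorem exists_first_cover {n m : ℕ} (hnm : n ≤ m) (G : SimpleGraph (Fin n)) :
    ∃ g, G.IsVertexCover (codeSet n m g : Set (Fin n)) ∧
      (∀ g' < g, ¬G.IsVertexCover (codeSet n m g' : Set (Fin n))) ∧
      ∀ S : Finset (Fin n), G.IsVertexCover (S : Set (Fin n)) →
        g < (2 * m) ^ S.card ∧ (2 * m) ^ (codeSet n m g).card ≤ (2 * m) ^ S.card := by
  classical
  have hcode : ∀ S : Finset (Fin n), ∃ g < (2 * m) ^ S.card, codeSet n m g = S := by
    intro S
    rcases Nat.eq_zero_or_pos m with rfl | hm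
    · obtain rfl : n = 0 := by omega
      have hS : S = ∅ := Subsingleton.elim _ _
      exact ⟨0, by simp [hS], Subsingleton.elim _ _⟩
    · obtain ⟨g, hg, hS⟩ := exists_code (b := 2 * m) (by omega) (by omega) S
      refine ⟨g, hg, ?_⟩
      ext a
      simp [codeSet, hS]
  have hex : ∃ g, G.IsVertexCover (codeSet n m g : Set (Fin n)) := by
    obtain ⟨g, -, hg⟩ := hcode Finset.univ
    exact ⟨g, fun a _ _ => by simp [hg]⟩
  obtain ⟨g₀, hg₀, hmin⟩ : ∃ g₀, G.IsVertexCover (codeSet n m g₀ : Set (Fin n)) ∧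
      ∀ g < g₀, ¬G.IsVertexCover (codeSet n m g : Set (Fin n)) :=
    ⟨Nat.find hex, Nat.find_spec hex, fun _ h => Nat.find_min hex h⟩
  refine ⟨g₀, hg₀, hmin, fun S hS => ?_⟩
  obtain ⟨g, hg, hgS⟩ := hcode S
  -- The search reaches the code of `S` unless it stops earlier. The size of the cover found then
  -- follows from the size of its code.
  have hlt : g₀ < (2 * m) ^ S.card :=
    lt_of_le_of_lt (not_lt.1 fun h => hmin g h (by rw [hgS]; exact hS)) hg
  refine ⟨hlt, ?_⟩
  have hcard : (codeSet n m g₀).card ≤ S.card := by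
    unfold codeSet
    convert card_code_le hlt
  rcases Nat.eq_zero_or_pos m with rfl | hm
  · obtain rfl : n = 0 := by omega
    have hS' : S = codeSet 0 0 g₀ := Subsingleton.elim _ _
    rw [← hS']
  · exact Nat.pow_le_pow_right (by omega) hcard

/-- With `X = n + m + 1`, the auction needs the most iterations, at most `X ^ 4 + X + 1`. `M` may be
exponential, since only its bit length enters the time, and an exponent quadratic in `X`
accommodates `(2 * m) ^ n`. -/
theorem exists_capacity {n m : ℕ} (hnm : n ≤ m) :
    Capacity n m (3 * (n + m + 1) ^ 4) (2 ^ (8 * (n + m + 1) ^ 2)) := by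
  set X := n + m + 1 with hX
  have hX1 : 1 ≤ X := by omega
  have hn : n + 1 ≤ X := by omega
  have hm : m ≤ X := by omega
  have hXX : X ≤ X * X := Nat.le_mul_of_pos_left _ hX1
  have hX3 : X * X ≤ X * X * X := Nat.le_mul_of_pos_right _ hX1
  have hX4' : X * X * X ≤ X * X * X * X := Nat.le_mul_of_pos_right _ hX1
  have hX4 : X ^ 4 = X * X * X * X := by ring
  have hcube : (n + 1) * (n + 1) * (n + 1) ≤ X * X * X :=
    Nat.mul_le_mul (Nat.mul_le_mul hn hn) hn
  have hX2 : X ≤ X ^ 2 := by rw [sq]; exact hXX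
  refine ⟨hnm, ?_, ?_, ?_, ?_, ?_, ?_, ?_⟩
  · calc 3 * X ^ 4 ≤ 2 ^ 2 * (2 ^ X) ^ 4 :=
        Nat.mul_le_mul (by norm_num) (Nat.pow_le_pow_left Nat.lt_two_pow_self.le 4)
      _ = 2 ^ (2 + X * 4) := by rw [pow_add 2 2, pow_mul]
      _ ≤ 2 ^ (8 * X ^ 2) := Nat.pow_le_pow_right (by norm_num) (by omega)
  · omega
  · have : n * n ≤ X * X := Nat.mul_le_mul (by omega) (by omega)
    omega
  · have : n * m ≤ X * X := Nat.mul_le_mul (by omega) (by omega)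
    omega
  · have h1 : m * ((n + 1) * (n + 1) * (n + 1) + 1) ≤ X * (X * X * X + 1) :=
      Nat.mul_le_mul hm (by omega)
    have h2 : X * (X * X * X + 1) = X * X * X * X + X := by ring
    omega
  · omega
  · have h1 : 2 * m ≤ 2 ^ X := by
      have h2 : m < 2 ^ m := Nat.lt_two_pow_self
      calc 2 * m ≤ 2 ^ (m + 1) := by rw [pow_succ]; omega
        _ ≤ 2 ^ X := Nat.pow_le_pow_right (by norm_num) (by omega)
    calc (2 * m) ^ n ≤ (2 ^ X) ^ n := Nat.pow_le_pow_left h1 n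
      _ = 2 ^ (X * n) := (pow_mul _ _ _).symm
      _ ≤ 2 ^ (8 * X ^ 2) := by
        refine Nat.pow_le_pow_right (by norm_num) ?_
        have : X * n ≤ X * X := Nat.mul_le_mul_left _ (by omega)
        rw [sq]
        omega

theorem bounded_inputMem {n m R M : ℕ} (hc : Capacity n m R M) (G : SimpleGraph (Fin n))
    (P : Fin n → Finset (Fin m)) : (inputMem G P).Bounded M := by
  have h1 := hc.iter_le
  have h2 := hc.houses_le
  have h3 := hc.le
  intro x i
  unfold inputMem
  split_ifs <;> omega

end HouseAllocation

open RAM HouseAllocation in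
/-- One program solves every instance that has an allocation, without being given a vertex cover,
and its running time is bounded in terms of the size of any vertex cover `S`, in particular of a
smallest one. -/
theorem theorem5p1 :
    ∃ (p : RAM.Cmd) (C c : ℕ), ∀ (n m : ℕ) (G : SimpleGraph (Fin n))
      (P : Fin n → Finset (Fin m)), n ≤ m →
      ∃ (t : ℕ) (s : RAM.Mem),
        RAM.Exec p (HouseAllocation.inputMem G P) t s ∧
        HouseAllocation.IsSolutionMem G P s ∧
        ∀ S : Finset (Fin n), G.IsVertexCover (S : Set (Fin n)) →
          t ≤ C * (2 * m) ^ S.card * (n + m + 1) ^ c := by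
  -- This composite program is never run; its bound is the sum of the three bounds needed, which
  -- yields common constants `K` and `d`.
  obtain ⟨K, d, hK⟩ := (Cmd.seq findCover (.seq initSearch evalGuess)).exists_bound_le
  refine ⟨solve, (3 * K + 81) * 10 * 4 ^ d, 2 + 4 * d, fun n m G P hnm => ?_⟩
  have hc := exists_capacity hnm
  obtain ⟨g, hg, hmin, hS⟩ := exists_first_cover hnm G
  set X := n + m + 1 with hX
  set R := 3 * X ^ 4 with hR
  set M := 2 ^ (8 * X ^ 2) with hM
  have hgM : g ≤ M := by
    have h1 := (hS Finset.univ fun a _ _ => by simp).1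
    rw [Finset.card_univ, Fintype.card_fin] at h1
    exact h1.le.trans hc.pow_le
  obtain ⟨t, s, h1, h2, -, h4⟩ := runs_solve hc (isInput_inputMem (G := G) (P := P))
    (by simp [inputMem]) hg hmin hgM (bounded_inputMem hc G P)
  refine ⟨t, s, h1, h4, fun S hSG => h2.trans ?_⟩
  obtain ⟨hgS, hTS⟩ := hS S hSG
  have hX1 : 1 ≤ X := by omega
  -- A power of two has one digit more than its exponent, so the left side is `8 * X ^ 2 + 2`.
  have hW : M.size + 1 ≤ 10 * X ^ 2 := by
    have := Nat.one_le_pow 2 X hX1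
    rw [hM, Nat.size_pow]
    omega
  have hR1 : R + 1 ≤ 4 * X ^ 4 := by
    have := Nat.one_le_pow 4 X hX1
    omega
  have hbound := hK (M.size + 1) R (by omega)
  simp only [Cmd.bound] at hbound
  have hY : 1 ≤ (2 * m) ^ S.card := by omega
  have hRd : 1 ≤ (R + 1) ^ d := Nat.one_le_pow _ _ (by omega)
  generalize (2 * m) ^ (codeSet n m g).card = N at *
  generalize (2 * m) ^ S.card = Y at *
  generalize findCover.bound (M.size + 1) R = B₁ at *
  generalize initSearch.bound (M.size + 1) R = B₂ at *
  generalize evalGuess.bound (M.size + 1) R = B₃ at *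
  generalize M.size + 1 = W at *
  -- Here `g + 1 ≤ Y` and `N ≤ Y`, so `N + 2 ≤ 3 * Y` because `1 ≤ Y`; this explains the factors `3`
  -- and `81 = 3 * 27`.
  calc (g + 1) * B₁ + (B₂ + (N + 2) * (27 * W + B₃))
      ≤ Y * B₁ + (Y * B₂ + (3 * Y) * (27 * W + B₃)) :=
        Nat.add_le_add (Nat.mul_le_mul_right _ hgS) (Nat.add_le_add
          (Nat.le_mul_of_pos_left _ hY) (Nat.mul_le_mul_right _ (by omega)))
    _ ≤ Y * (3 * (B₁ + (B₂ + B₃)) + 81 * W) := by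
        nlinarith [Nat.zero_le (Y * B₁), Nat.zero_le (Y * B₂)]
    _ ≤ Y * (3 * (K * W * (R + 1) ^ d) + 81 * (W * (R + 1) ^ d)) :=
        Nat.mul_le_mul_left _ (Nat.add_le_add (Nat.mul_le_mul_left _ hbound)
          (Nat.mul_le_mul_left _ (Nat.le_mul_of_pos_right _ hRd)))
    _ = (3 * K + 81) * Y * (W * (R + 1) ^ d) := by ring
    _ ≤ (3 * K + 81) * Y * (10 * X ^ 2 * (4 * X ^ 4) ^ d) :=
        Nat.mul_le_mul_left _ (Nat.mul_le_mul hW (Nat.pow_le_pow_left hR1 d))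
    _ = (3 * K + 81) * 10 * 4 ^ d * Y * X ^ (2 + 4 * d) := by
        rw [mul_pow, ← pow_mul, pow_add]
        ring
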